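/- A permutation $\pi=\pi(1)\cdots\pi(n)$ is \emph{Baxter} if there are no $i<j<k$ such that $\pi(j+1)<\pi(i)<\pi(k)<\pi(j)$ or $\pi(j)<\pi(k)<\pi(i)<\pi(j+1)$. It \emph{contains} a pattern $\tau=\tau_1\cdots\tau_k$ if some subsequence $\pi(i_1)\cdots\pi(i_k)$, $i_1<\dots<i_k$, is order-isomorphic to $\tau$. Let $\pi$ be a Baxter permutation of size $n$, and set $\pi(0)=0$, $\pi(n+1)=n+1$. Consider in $\mathbb R^2$ the black points $b_i=(i,\pi(i))$, $1\le i\le n$, and, for each $a\in\{0,\dots,n\}$ with $\pi(a)<\pi(a+1)$, the white point $w_a=(a+\tfrac12,\ell_a+\tfrac12)$, where $\ell_a=\max\{\pi(i): 0\le i<a+1,\ \pi(i)<\pi(a+1)\}$; in particular $w_0=(\tfrac12,\tfrac12)$ and $w_n=(n+\tfrac12,n+\tfrac12)$. Let $\phi(\pi)$ be the Hasse diagram of this set of points for the product order on $\mathbb R^2$, drawn with straight edges oriented to the North-East. Every black point covers exactly one point and is covered by exactly one point, and both are white. The plane bipolar orientation $O=\Phi(\pi)$ is obtained from $\phi(\pi)$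 by erasing the black points: its vertices are the white points, and each point $b_i$ gives one edge, from the white point covered by $b_i$ to the white point covering $b_i$; its source is $w_0$ and its sink is $w_n$. The border of each inner (i.e. bounded) face $f$ of $O$ consists of two oriented paths with a common starting point, the \emph{source} of $f$, and a common endpoint, the \emph{sink} of $f$. The vertices other than the source and the sink of $f$ on the path that has $f$ on its right (resp. left) are the \emph{left} (resp. \emph{right}) \emph{vertices} of $f$. A \emph{right-oriented piece} (ROP) of $O$ is a $4$-tuple $(v_1,v_2,f_1,f_2)$ of two vertices $v_1,v_2$ and two inner faces $f_1,f_2$ of $O$ such that $v_1$ is the source of $f_1$ and a left vertex of $f_2$, and $v_2$ is the sink of $f_2$ and a right vertex of $f_1$. A \emph{left-oriented piece} (LOP) is defined in the same way with "left" and "right" exchanged. \textbf{Proposition.} Let $\pi$ be a Baxter permutation. Then $\pi$ contains the pattern $2413$ if and only if $\Phi(\pi)$ contains a ROP, and $\pi$ contains the pattern $3142$ if and only if $\Phi(\pi)$ contains a LOP. -/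

import Mathlib

namespace BaxterBipolar

/-! ## Permutations -/

/-- `π` is Baxter: there are no `i < j < k` with `π(j+1) < π(i) < π(k) < π(j)` or
`π(j) < π(k) < π(i) < π(j+1)` (here `j'` stands for `j + 1`). -/
def IsBaxter {n : ℕ} (π : Equiv.Perm (Fin n)) : Prop :=
  ∀ i j j' k : Fin n, i < j → j < k → (j' : ℕ) = (j : ℕ) + 1 →
    ¬ (π j' < π i ∧ π i < π k ∧ π k < π j) ∧ ¬ (π j < π k ∧ π k < π i ∧ π i < π j')

/-- `π` contains the pattern `τ`, given by the word `τ 0, τ 1, …, τ (k-1)`: some subsequence of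
`π` is order-isomorphic to this word. -/
def ContainsPattern {n k : ℕ} (π : Equiv.Perm (Fin n)) (τ : Fin k → ℕ) : Prop :=
  ∃ f : Fin k → Fin n, StrictMono f ∧ ∀ a b : Fin k, π (f a) < π (f b) ↔ τ a < τ b

/-! ## Oriented maps

A digraph drawn on an oriented surface, up to deformation, is encoded in the classical way by the
clockwise rotation of the half-edges around each vertex.
The half-edge of `e` at its tail is `(e, true)`, the one at its head is `(e, false)`. -/

structure OrientedMap where
  V : Type
  E : Type
  tail : E → V
  head : E → V
  /-- the half-edge that follows a given half-edge in clockwise order around their vertex -/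
  cw : Equiv.Perm (E × Bool)
  cw_sameCycle : ∀ d d' : E × Bool, cw.SameCycle d d' ↔
    (if d.2 then tail d.1 else head d.1) = (if d'.2 then tail d'.1 else head d'.1)

namespace OrientedMap

variable (O : OrientedMap)

/-- the half-edges -/
abbrev Dart : Type := O.E × Bool

/-- the other half of the same edge -/
def flip : Equiv.Perm O.Dart := (Equiv.refl O.E).prodCongr Equiv.boolNot

/-- Walk along the edge of the half-edge `d`, starting from the vertex of `d`, keeping the face on
the left-hand side. At the other end, the walk continues with the half-edge that
comes next in clockwise order. -/
def faceStep : Equiv.Perm O.Dart := O.flip.trans O.cw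

/-- The faces of the map are the orbits of `faceStep`. -/
def Face : Type := Quotient (Equiv.Perm.SameCycle.setoid O.faceStep)

/-- the face on the left of the edge `e` (oriented from tail to head) -/
def leftFace (e : O.E) : O.Face := Quotient.mk _ (e, true)

/-- the face on the right of the edge `e` (oriented from tail to head) -/
def rightFace (e : O.E) : O.Face := Quotient.mk _ (e, false)

/-- `e` is one of the edges of the border of `f`. -/
def IsBorderEdge (e : O.E) (f : O.Face) : Prop := O.leftFace e = f ∨ O.rightFace e = f

/-- `v` is the source of the border of `f`: a vertex of the border at which no edge of the
border ends. -/
def IsFaceSource (v : O.V) (f : O.Face) : Prop :=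
  (∃ e, O.IsBorderEdge e f ∧ O.tail e = v) ∧ ∀ e, O.IsBorderEdge e f → O.head e ≠ v

/-- `v` is the sink of the border of `f`: a vertex of the border at which no edge of the
border starts. -/
def IsFaceSink (v : O.V) (f : O.Face) : Prop :=
  (∃ e, O.IsBorderEdge e f ∧ O.head e = v) ∧ ∀ e, O.IsBorderEdge e f → O.tail e ≠ v

/-- `v` is a left vertex of `f`: it lies on the left border of `f` (formed by the edges
having `f` on their right) and is neither the source nor the sink of `f`. -/
def IsLeftVertex (v : O.V) (f : O.Face) : Prop :=
  (∃ e, O.rightFace e = f ∧ (O.tail e = v ∨ O.head e = v)) ∧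
    ¬ O.IsFaceSource v f ∧ ¬ O.IsFaceSink v f

/-- `v` is a right vertex of `f`: it lies on the right border of `f` (formed by the edges
having `f` on their left) and is neither the source nor the sink of `f`. -/
def IsRightVertex (v : O.V) (f : O.Face) : Prop :=
  (∃ e, O.leftFace e = f ∧ (O.tail e = v ∨ O.head e = v)) ∧
    ¬ O.IsFaceSource v f ∧ ¬ O.IsFaceSink v f

end OrientedMap

/-- An oriented map with a distinguished outer face. (`IsOuter` is a predicate because a map
without edges has no face in the encoding by half-edges.) -/
structure PlaneOrientedMap extends OrientedMap where
  IsOuter : toOrientedMap.Face → Prop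

namespace PlaneOrientedMap

variable (O : PlaneOrientedMap)

/-- `(v₁, v₂, f₁, f₂)` is a right-oriented piece. -/
def IsROP (v₁ v₂ : O.V) (f₁ f₂ : O.Face) : Prop :=
  ¬ O.IsOuter f₁ ∧ ¬ O.IsOuter f₂ ∧
    O.IsFaceSource v₁ f₁ ∧ O.IsLeftVertex v₁ f₂ ∧
    O.IsFaceSink v₂ f₂ ∧ O.IsRightVertex v₂ f₁

/-- `(v₁, v₂, f₁, f₂)` is a left-oriented piece. -/
def IsLOP (v₁ v₂ : O.V) (f₁ f₂ : O.Face) : Prop :=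
  ¬ O.IsOuter f₁ ∧ ¬ O.IsOuter f₂ ∧
    O.IsFaceSource v₁ f₁ ∧ O.IsRightVertex v₁ f₂ ∧
    O.IsFaceSink v₂ f₂ ∧ O.IsLeftVertex v₂ f₁

end PlaneOrientedMap

/-! ## Rotations -/

section Rotation

variable {D W K : Type} [LinearOrder K] (o : D → W) (key : D → K)

/-- `d'` comes next after `d` in the cyclic order, by increasing `key`, of the elements `x` with
the same `o x`. -/
def IsNext (d d' : D) : Prop :=
  o d' = o d ∧
    ((key d < key d' ∧ ∀ x, o x = o d → key d < key x → key d' ≤ key x) ∨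
      ((∀ x, o x = o d → key x ≤ key d) ∧ ∀ x, o x = o d → key d' ≤ key x))

theorem exists_isNext [Finite D] (d : D) : ∃ d', IsNext o key d d' := by
  by_cases h : ∃ x, o x = o d ∧ key d < key x
  · obtain ⟨d', h1, h2⟩ := Set.exists_min_image {x | o x = o d ∧ key d < key x} key
      (Set.toFinite _) h
    exact ⟨d', h1.1, Or.inl ⟨h1.2, fun x hx hx' => h2 x ⟨hx, hx'⟩⟩⟩
  · push Not at h
    obtain ⟨d', h1, h2⟩ := Set.exists_min_image {x | o x = o d} key (Set.toFinite _) ⟨d, rfl⟩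
    exact ⟨d', h1, Or.inr ⟨h, fun x hx => h2 x hx⟩⟩

variable {o key} in
theorem IsNext.unique (hinj : ∀ d d', o d = o d' → key d = key d' → d = d') {d d' d'' : D}
    (h' : IsNext o key d d') (h'' : IsNext o key d d'') : d' = d'' := by
  obtain ⟨e', h'⟩ := h'
  obtain ⟨e'', h''⟩ := h''
  refine hinj _ _ (e'.trans e''.symm) ?_
  rcases h' with ⟨h1, h2⟩ | ⟨h1, h2⟩ <;> rcases h'' with ⟨h3, h4⟩ | ⟨h3, h4⟩
  · exact le_antisymm (h2 _ e'' h3) (h4 _ e' h1)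
  · exact absurd h1 (not_lt_of_ge (h3 _ e'))
  · exact absurd h3 (not_lt_of_ge (h1 _ e''))
  · exact le_antisymm (h2 _ e'') (h4 _ e')

variable {o key} in
theorem IsNext.key_le {d e x : D} (hd : IsNext o key d x) (he : IsNext o key e x) :
    key d ≤ key e := by
  by_contra hlt
  rw [not_le] at hlt
  obtain ⟨e1, hd⟩ := hd
  obtain ⟨e2, he⟩ := he
  have e3 : o d = o e := e1.symm.trans e2
  rcases he with ⟨h1, h2⟩ | ⟨h1, _⟩
  · have h3 := h2 d e3 hlt
    rcases hd with ⟨h4, _⟩ | ⟨_, h4⟩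
    · exact absurd h3 (not_le_of_gt h4)
    · exact absurd h1 (not_lt_of_ge (h4 e e3.symm))
  · exact absurd hlt (not_lt_of_ge (h1 d e3))

/-- The permutation that sends each `d` to the next element in the cyclic order of `IsNext`. -/
noncomputable def rotation [Finite D] (hinj : ∀ d d', o d = o d' → key d = key d' → d = d') :
    Equiv.Perm D :=
  Equiv.ofBijective (fun d => Classical.choose (exists_isNext o key d)) <|
    Finite.injective_iff_bijective.1 fun d e h => by
      have h1 := Classical.choose_spec (exists_isNext o key d)
      have h2 := Classical.choose_spec (exists_isNext o key e)
      rw [← h] at h2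
      exact hinj d e (h1.1.symm.trans h2.1) (le_antisymm (h1.key_le h2) (h2.key_le h1))

theorem rotation_isNext [Finite D] (hinj : ∀ d d', o d = o d' → key d = key d' → d = d') (d : D) :
    IsNext o key d (rotation o key hinj d) :=
  Classical.choose_spec (exists_isNext o key d)

theorem rotation_sameCycle [Finite D] (hinj : ∀ d d', o d = o d' → key d = key d' → d = d')
    (d d' : D) : (rotation o key hinj).SameCycle d d' ↔ o d = o d' := by
  set f := rotation o key hinj with hf
  have hstep : ∀ x, o (f x) = o x := fun x => (rotation_isNext o key hinj x).1
  constructor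
  · intro h
    obtain ⟨k, hk, rfl⟩ := h.exists_pow_eq'
    clear h hk
    induction k with
    | zero => rfl
    | succ k ih => rw [pow_succ', Equiv.Perm.mul_apply, hstep, ← ih]
  · intro h
    obtain ⟨m, hm, hmax⟩ := Set.exists_max_image {x | o x = o d} key (Set.toFinite _) ⟨d, rfl⟩
    -- every element reaches the largest one of its class
    have hreach : ∀ x, o x = o d → f.SameCycle x m := by
      by_contra hcon
      push Not at hcon
      obtain ⟨x, ⟨hx1, hx2⟩, hx3⟩ := Set.exists_max_image
        {x | o x = o d ∧ ¬ f.SameCycle x m} key (Set.toFinite _) hcon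
      have h1 : f.SameCycle x (f x) := ⟨1, by simp⟩
      obtain ⟨e1, h2 | h2⟩ := rotation_isNext o key hinj x
      · exact absurd h2.1 (not_lt_of_ge
          (hx3 (f x) ⟨e1.trans hx1, fun h3 => hx2 (h1.trans h3)⟩))
      · have h3 : x = m := hinj _ _ (hx1.trans hm.symm)
          (le_antisymm (hmax x hx1) (h2.1 m (hm.trans hx1.symm)))
        exact hx2 (h3 ▸ Equiv.Perm.SameCycle.refl f x)
    exact (hreach d rfl).trans (hreach d' h.symm).symm

end Rotation

/-! ## The Hasse diagram `φ(π)` -/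

section Hasse

variable {n : ℕ} (π : Equiv.Perm (Fin n))

/-- The values `π(0) = 0, π(1), …, π(n), π(n+1) = n+1`, with positions and values
starting from `1` for the permutation itself. -/
def word : ℕ → ℕ
  | 0 => 0
  | i + 1 => if h : i < n then (π ⟨i, h⟩ : ℕ) + 1 else n + 1

/-- The ascents of `π(0) π(1) … π(n) π(n+1)`: the ascents of `π`, together with `0` and `n`.
They index the white vertices. -/
def Ascent : Type := {a : ℕ // a ≤ n ∧ word π a < word π (a + 1)}

/-- `ℓ_a = max {π(i) : i < a+1, π(i) < π(a+1)}` -/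
def ell (a : ℕ) : ℕ := ((Finset.range (a + 1)).filter fun i => word π i < word π (a + 1)).sup (word π)

/-- the black vertices `b_i = (i, π(i))`, `1 ≤ i ≤ n`; the index is shifted by one -/
noncomputable def black (i : Fin n) : ℝ × ℝ := (((i : ℕ) + 1 : ℕ), (word π ((i : ℕ) + 1) : ℕ))

/-- the white vertices `w_a = (a + 1/2, ℓ_a + 1/2)`; in particular `w_0 = (1/2, 1/2)` and
`w_n = (n + 1/2, n + 1/2)` -/
noncomputable def white (a : Ascent π) : ℝ × ℝ := ((a.1 : ℝ) + 1 / 2, (ell π a.1 : ℝ) + 1 / 2)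

/-- The vertices of `φ(π)`, as a subset of the plane. The order on `ℝ × ℝ` is the product order,
so that the edges of the Hasse diagram `φ(π)` are the pairs `u ⋖ v` in this subset. -/
def vertexSet : Set (ℝ × ℝ) := Set.range (black π) ∪ Set.range (white π)

noncomputable def blackVertex (i : Fin n) : vertexSet π := ⟨black π i, Or.inl ⟨i, rfl⟩⟩

noncomputable def whiteVertex (a : Ascent π) : vertexSet π := ⟨white π a, Or.inr ⟨a, rfl⟩⟩

theorem word_succ (i : Fin n) : word π ((i : ℕ) + 1) = (π i : ℕ) + 1 := by
  simp [word]

theorem word_last : word π (n + 1) = n + 1 := by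
  simp [word]

theorem word_le (i : ℕ) : word π i ≤ n + 1 := by
  rcases i with _ | i
  · simp [word]
  · by_cases h : i < n
    · have := (π ⟨i, h⟩).isLt
      simp only [word, h, dif_pos]; omega
    · simp [word, h]

theorem word_inj {i k : ℕ} (hi : i ≤ n + 1) (hk : k ≤ n + 1) (h : word π i = word π k) :
    i = k := by
  rcases i with _ | i <;> rcases k with _ | k
  · rfl
  · simp only [word] at h; split_ifs at h
  · simp only [word] at h; split_ifs at h
  · simp only [word] at h
    split_ifs at h with h1 h2 h2
    · have h3 : π ⟨i, h1⟩ = π ⟨k, h2⟩ := Fin.ext (by omega)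
      have h4 := π.injective h3
      simp only [Fin.mk.injEq] at h4
      omega
    · have := (π ⟨i, h1⟩).isLt; omega
    · have := (π ⟨k, h2⟩).isLt; omega
    · omega

theorem word_baxter (hπ : IsBaxter π) {i j k : ℕ} (hij : i < j) (hjk : j < k) (hk : k ≤ n + 1) :
    ¬ (word π (j + 1) < word π i ∧ word π i < word π k ∧ word π k < word π j) ∧
    ¬ (word π j < word π k ∧ word π k < word π i ∧ word π i < word π (j + 1)) := by
  rcases i with _ | i
  · simp [word]
  rcases hk.eq_or_lt with rfl | hk
  · have h1 := word_le π j
    have h2 := word_le π (i + 1)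
    rw [word_last]; omega
  obtain ⟨j, rfl⟩ : ∃ j', j = j' + 1 := ⟨j - 1, by omega⟩
  obtain ⟨k, rfl⟩ : ∃ k', k = k' + 1 := ⟨k - 1, by omega⟩
  have := hπ ⟨i, by omega⟩ ⟨j, by omega⟩ ⟨j + 1, by omega⟩ ⟨k, by omega⟩
    (by simpa using hij) (by simpa using hjk) rfl
  have e1 := word_succ π ⟨i, by omega⟩
  have e2 := word_succ π ⟨j, by omega⟩
  have e3 := word_succ π ⟨j + 1, by omega⟩
  have e4 := word_succ π ⟨k, by omega⟩
  simp only [Fin.lt_def] at this e1 e2 e3 e4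
  omega

theorem le_ell {a i : ℕ} (hi : i ≤ a) (h : word π i < word π (a + 1)) : word π i ≤ ell π a :=
  Finset.le_sup (f := word π) (by simp; omega)

theorem exists_ell {a : ℕ} (ha : word π a < word π (a + 1)) :
    ∃ i ≤ a, word π i < word π (a + 1) ∧ word π i = ell π a := by
  obtain ⟨i, hi, h⟩ := Finset.exists_mem_eq_sup
    ((Finset.range (a + 1)).filter fun i => word π i < word π (a + 1))
    ⟨a, by simpa using ha⟩ (word π)
  simp only [Finset.mem_filter, Finset.mem_range] at hi
  exact ⟨i, by omega, hi.2, h.symm⟩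

theorem ell_lt (hπ : IsBaxter π) {a k : ℕ} (ha : word π a < word π (a + 1)) (hk : a < k)
    (hkn : k ≤ n + 1) (h : word π a < word π k) : ell π a < word π k := by
  obtain ⟨i, hi, h1, h2⟩ := exists_ell π ha
  by_contra hlt
  have hne : word π k ≠ word π i := fun e => by
    have := word_inj π hkn (by omega) e
    omega
  have hia : i ≠ a := by rintro rfl; omega
  exact (word_baxter π hπ (show i < a by omega) hk hkn).2 (by omega)

theorem black_lt_white (i : Fin n) (a : Ascent π) :
    blackVertex π i < whiteVertex π a ↔ (i : ℕ) + 1 ≤ a.1 ∧ word π ((i : ℕ) + 1) ≤ ell π a.1 := by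
  have key : ∀ p q : ℕ, ((p : ℝ) ≤ (q : ℝ) + 1 / 2 ↔ p ≤ q) ∧ ((q : ℝ) + 1 / 2 ≤ p ↔ q < p) := by
    intro p q
    have hpq : p ≤ q ∨ q + 1 ≤ p := by omega
    rcases hpq with h | h <;> have h' := h <;> rify at h' <;> constructor <;> constructor <;>
      intro h2 <;> first | omega | linarith
  change black π i < white π a ↔ _
  rw [Prod.lt_iff]
  simp only [black, white, lt_iff_not_ge, (key _ _).1, (key _ _).2]
  omega

theorem white_lt_black (i : Fin n) (a : Ascent π) :
    whiteVertex π a < blackVertex π i ↔ a.1 < (i : ℕ) + 1 ∧ ell π a.1 < word π ((i : ℕ) + 1) := by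
  have key : ∀ p q : ℕ, ((p : ℝ) ≤ (q : ℝ) + 1 / 2 ↔ p ≤ q) ∧ ((q : ℝ) + 1 / 2 ≤ p ↔ q < p) := by
    intro p q
    have hpq : p ≤ q ∨ q + 1 ≤ p := by omega
    rcases hpq with h | h <;> have h' := h <;> rify at h' <;> constructor <;> constructor <;>
      intro h2 <;> first | omega | linarith
  change white π a < black π i ↔ _
  rw [Prod.lt_iff]
  simp only [black, white, lt_iff_not_ge, (key _ _).1, (key _ _).2]
  omega

theorem black_le_black (i k : Fin n) :
    blackVertex π i ≤ blackVertex π k ↔ i ≤ k ∧ word π ((i : ℕ) + 1) ≤ word π ((k : ℕ) + 1) := by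
  change black π i ≤ black π k ↔ _
  rw [Prod.le_def]
  simp [black]

theorem white_le_white (a c : Ascent π) :
    whiteVertex π a ≤ whiteVertex π c ↔ a.1 ≤ c.1 ∧ ell π a.1 ≤ ell π c.1 := by
  change white π a ≤ white π c ↔ _
  rw [Prod.le_def]
  simp [white]

theorem whiteVertex_injective : Function.Injective (whiteVertex π) := by
  intro a c h
  have h1 := (white_le_white π a c).1 h.le
  have h2 := (white_le_white π c a).1 h.ge
  exact Subtype.ext (le_antisymm h1.1 h2.1)

theorem black_ne_white (i : Fin n) (a : Ascent π) : blackVertex π i ≠ whiteVertex π a := by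
  intro h
  have h1 := black_lt_white π i a
  have h2 := white_lt_black π i a
  rw [h] at h1 h2
  simp only [lt_self_iff_false, false_iff] at h1 h2
  by_cases h3 : (i : ℕ) + 1 ≤ a.1
  · have h4 : (black π i).1 = (white π a).1 := by
      rw [show black π i = white π a from congrArg Subtype.val h]
    simp only [black, white] at h4
    rify at h3
    push_cast at h4
    linarith
  · have h4 : (black π i).1 = (white π a).1 := by
      rw [show black π i = white π a from congrArg Subtype.val h]
    simp only [black, white] at h4
    have h5 : a.1 + 1 ≤ (i : ℕ) + 1 := by omega
    rify at h5
    push_cast at h4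
    linarith

theorem vertex_cases (z : vertexSet π) :
    (∃ i, z = blackVertex π i) ∨ ∃ a, z = whiteVertex π a := by
  obtain ⟨z, ⟨i, rfl⟩ | ⟨a, rfl⟩⟩ := z
  · exact Or.inl ⟨i, rfl⟩
  · exact Or.inr ⟨a, rfl⟩

/-- Above every black vertex there is a least vertex, and it is white. -/
theorem exists_least_above (hπ : IsBaxter π) (i : Fin n) :
    ∃ a : Ascent π, ∀ z, blackVertex π i < z ↔ whiteVertex π a ≤ z := by
  have hex : ∃ j, (i : ℕ) + 1 < j ∧ word π ((i : ℕ) + 1) < word π j := by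
    refine ⟨n + 1, by omega, ?_⟩
    rw [word_last, word_succ]; omega
  classical
  obtain ⟨hj1, hj2⟩ := Nat.find_spec hex
  have hmin := fun m => Nat.find_min (m := m) hex
  have hjn : Nat.find hex ≤ n + 1 := Nat.find_min' hex
    ⟨by omega, by rw [word_last, word_succ]; omega⟩
  set j := Nat.find hex with hj
  clear_value j
  obtain ⟨a, rfl⟩ : ∃ a, j = a + 1 := ⟨j - 1, by omega⟩
  have hmin' : ∀ m, (i : ℕ) + 1 ≤ m → m ≤ a → word π m ≤ word π ((i : ℕ) + 1) := by
    intro m h1 h2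
    rcases h1.eq_or_lt with rfl | h1
    · exact le_rfl
    · by_contra h3
      exact hmin m (by omega) ⟨h1, by omega⟩
  have ha := hmin' a (by omega) le_rfl
  have hasc : word π a < word π (a + 1) := by omega
  have hell : word π ((i : ℕ) + 1) ≤ ell π a := le_ell π (by omega) hj2
  refine ⟨⟨a, by omega, hasc⟩, fun z => ⟨fun hz => ?_, fun hz =>
    lt_of_lt_of_le ((black_lt_white π _ _).2 ⟨by simpa using by omega, hell⟩) hz⟩⟩
  rcases vertex_cases π z with ⟨k, rfl⟩ | ⟨c, rfl⟩
  · have h1 := (black_le_black π i k).1 hz.le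
    have h2 : i ≠ k := by rintro rfl; exact lt_irrefl _ hz
    have h3 : word π ((i : ℕ) + 1) ≠ word π ((k : ℕ) + 1) := fun e => h2 (Fin.ext (by
      have := word_inj π (by omega) (by omega) e
      omega))
    have h4 : a < (k : ℕ) + 1 := by
      by_contra h5
      have := hmin' ((k : ℕ) + 1) (by have := h1.1; rw [Fin.le_def] at this; omega) (by omega)
      omega
    have h5 : ell π a < word π ((k : ℕ) + 1) :=
      ell_lt π hπ hasc h4 (by omega) (by have := h1.2; omega)
    exact ((white_lt_black π k ⟨a, by omega, hasc⟩).2 ⟨h4, h5⟩).le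
  · obtain ⟨h1, h2⟩ := (black_lt_white π i c).1 hz
    obtain ⟨i0, h3, h4, h5⟩ := exists_ell π c.2.2
    have h6 : a ≤ c.1 := by
      by_contra h7
      have := hmin' (c.1 + 1) (by omega) (by omega)
      omega
    refine (white_le_white π _ _).2 ⟨h6, ?_⟩
    have h8 : ell π a < word π (c.1 + 1) :=
      ell_lt π hπ hasc (by omega) (by have := c.2.1; omega) (by omega)
    obtain ⟨i1, h9, h10, h11⟩ := exists_ell π hasc
    show ell π a ≤ ell π c.1
    rw [← h11] at h8 ⊢
    exact le_ell π (by omega) h8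

/-- Below every black vertex there is a greatest vertex, and it is white. -/
theorem exists_greatest_below (hπ : IsBaxter π) (i : Fin n) :
    ∃ a : Ascent π, ∀ z, z < blackVertex π i ↔ z ≤ whiteVertex π a := by
  classical
  obtain ⟨k0, hk0, hm⟩ := Finset.exists_max_image
    ((Finset.range ((i : ℕ) + 1)).filter fun k => word π k < word π ((i : ℕ) + 1)) (word π)
    ⟨0, by simp [word]⟩
  simp only [Finset.mem_filter, Finset.mem_range] at hk0 hm
  have hex : ∃ j, k0 < j ∧ word π k0 < word π j := ⟨(i : ℕ) + 1, hk0⟩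
  obtain ⟨hj1, hj2⟩ := Nat.find_spec hex
  have hmin := fun m => Nat.find_min (m := m) hex
  have hji : Nat.find hex ≤ (i : ℕ) + 1 := Nat.find_min' hex hk0
  set j := Nat.find hex with hj
  clear_value j
  obtain ⟨a, rfl⟩ : ∃ a, j = a + 1 := ⟨j - 1, by omega⟩
  have hmin' : ∀ m, k0 ≤ m → m ≤ a → word π m ≤ word π k0 := by
    intro m h1 h2
    rcases h1.eq_or_lt with rfl | h1
    · exact le_rfl
    · by_contra h3
      exact hmin m (by omega) ⟨h1, by omega⟩
  have ha := hmin' a (by omega) le_rfl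
  have hasc : word π a < word π (a + 1) := by omega
  have hell1 : word π k0 ≤ ell π a := le_ell π (by omega) hj2
  have hell2 : ell π a < word π ((i : ℕ) + 1) :=
    ell_lt π hπ hasc (by omega) (by omega) (by omega)
  -- no smaller value occurs between the positions `a + 1` and `i`
  have hno : ∀ k, a < k → k < (i : ℕ) + 1 → word π ((i : ℕ) + 1) ≤ word π k := by
    intro k h1 h2
    induction k with
    | zero => omega
    | succ k ih =>
      by_contra h3
      have h4 := hm (k + 1) ⟨h2, by omega⟩
      have h5 : k ≠ a := by rintro rfl; omega
      have h6 := ih (by omega) (by omega)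
      have h7 : word π (k + 1) ≠ word π k0 := fun e => by
        have := word_inj π (by omega) (by omega) e
        omega
      have h8 : word π ((i : ℕ) + 1) ≠ word π k := fun e => by
        have := word_inj π (by omega) (by omega) e
        omega
      exact (word_baxter π hπ (i := k0) (j := k) (k := (i : ℕ) + 1) (by omega) (by omega)
        (by omega)).1 (by omega)
  refine ⟨⟨a, by omega, hasc⟩, fun z => ⟨fun hz => ?_, fun hz =>
    lt_of_le_of_lt hz ((white_lt_black π _ _).2 ⟨by simpa using by omega, hell2⟩)⟩⟩
  rcases vertex_cases π z with ⟨k, rfl⟩ | ⟨c, rfl⟩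
  · have h1 := (black_le_black π k i).1 hz.le
    have h2 : k ≠ i := by rintro rfl; exact lt_irrefl _ hz
    have h3 : word π ((k : ℕ) + 1) ≠ word π ((i : ℕ) + 1) := fun e => h2 (Fin.ext (by
      have := word_inj π (by omega) (by omega) e
      omega))
    have h4 : (k : ℕ) < i := by
      have h5 := h1.1
      rw [Fin.le_def] at h5
      have h6 : (k : ℕ) ≠ i := fun e => h2 (Fin.ext e)
      omega
    refine ((black_lt_white π _ _).2 ⟨?_, ?_⟩).le
    · show (k : ℕ) + 1 ≤ a
      by_contra h7
      have := hno ((k : ℕ) + 1) (by omega) (by omega)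
      omega
    · exact (hm _ ⟨by omega, by omega⟩).trans hell1
  · obtain ⟨h1, h2⟩ := (white_lt_black π i c).1 hz
    obtain ⟨i0, h3, h4, h5⟩ := exists_ell π c.2.2
    refine (white_le_white π _ _).2 ⟨?_, ?_⟩
    · show c.1 ≤ a
      by_contra h6
      have h7 := hno c.1 (by omega) h1
      have h8 := le_ell π le_rfl c.2.2
      omega
    · show ell π c.1 ≤ ell π a
      rw [← h5]
      exact (hm i0 ⟨by omega, by omega⟩).trans hell1

/-- Every black vertex is covered by exactly one vertex, which is white. -/
theorem exists_head (hπ : IsBaxter π) (i : Fin n) :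
    ∃ a : Ascent π, ∀ z, blackVertex π i ⋖ z ↔ z = whiteVertex π a := by
  obtain ⟨a, ha⟩ := exists_least_above π hπ i
  refine ⟨a, fun z => ⟨fun h => ?_, ?_⟩⟩
  · rcases ((ha z).1 h.1).eq_or_lt with h1 | h1
    · exact h1.symm
    · exact absurd h1 (h.2 ((ha _).2 le_rfl))
  · rintro rfl
    exact ⟨(ha _).2 le_rfl, fun c h1 h2 => absurd ((ha c).1 h1) (not_le_of_gt h2)⟩

/-- Every black vertex covers exactly one vertex, which is white. -/
theorem exists_tail (hπ : IsBaxter π) (i : Fin n) :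
    ∃ a : Ascent π, ∀ z, z ⋖ blackVertex π i ↔ z = whiteVertex π a := by
  obtain ⟨a, ha⟩ := exists_greatest_below π hπ i
  refine ⟨a, fun z => ⟨fun h => ?_, ?_⟩⟩
  · rcases ((ha z).1 h.1).eq_or_lt with h1 | h1
    · exact h1
    · exact absurd ((ha _).2 le_rfl) (h.2 h1)
  · rintro rfl
    exact ⟨(ha _).2 le_rfl, fun c h1 h2 => absurd ((ha c).1 h2) (not_le_of_gt h1)⟩

/-! ## The plane bipolar orientation `Φ(π)` -/

/-- the start of the edge of `Φ(π)` that corresponds to the `i`-th point of `π`: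
the white vertex covered by this point -/
noncomputable def tailOf (hπ : IsBaxter π) (i : Fin n) : Ascent π :=
  Classical.choose (exists_tail π hπ i)

/-- the end of the edge of `Φ(π)` that corresponds to the `i`-th point of `π`:
the white vertex that covers this point -/
noncomputable def headOf (hπ : IsBaxter π) (i : Fin n) : Ascent π :=
  Classical.choose (exists_head π hπ i)

theorem covBy_black_iff (hπ : IsBaxter π) (i : Fin n) (z : vertexSet π) :
    z ⋖ blackVertex π i ↔ z = whiteVertex π (tailOf π hπ i) :=
  Classical.choose_spec (exists_tail π hπ i) z

theorem black_covBy_iff (hπ : IsBaxter π) (i : Fin n) (z : vertexSet π) :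
    blackVertex π i ⋖ z ↔ z = whiteVertex π (headOf π hπ i) :=
  Classical.choose_spec (exists_head π hπ i) z

/-- the slope of the straight line through two points of the plane -/
noncomputable def lineSlope (u v : ℝ × ℝ) : ℝ := (v.2 - u.2) / (v.1 - u.1)

/-- the white vertex of a half-edge -/
noncomputable def originOf (hπ : IsBaxter π) (d : Fin n × Bool) : Ascent π :=
  if d.2 then tailOf π hπ d.1 else headOf π hπ d.1

/-- The position of a half-edge in the clockwise order around its white vertex, starting from
the North. As all edges of `φ(π)` point to the North-East, one first finds the outgoing edges by
decreasing slope, and then, from South to West, the ingoing edges by decreasing slope. -/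
noncomputable def clockwiseKey (hπ : IsBaxter π) (d : Fin n × Bool) : ℕ ×ₗ ℝ :=
  toLex (if d.2 then 0 else 1, - lineSlope (white π (originOf π hπ d)) (black π d.1))

theorem not_black_lt_of_same_tail (hπ : IsBaxter π) {i k : Fin n}
    (h : tailOf π hπ i = tailOf π hπ k) : ¬ blackVertex π i < blackVertex π k := fun hlt =>
  ((covBy_black_iff π hπ k _).2 rfl).2 (h ▸ ((covBy_black_iff π hπ i _).2 rfl).1) hlt

theorem not_black_lt_of_same_head (hπ : IsBaxter π) {i k : Fin n}
    (h : headOf π hπ i = headOf π hπ k) : ¬ blackVertex π i < blackVertex π k := fun hlt =>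
  ((black_covBy_iff π hπ i _).2 rfl).2 hlt (h ▸ ((black_covBy_iff π hπ k _).2 rfl).1)

theorem slope_ne {i k : Fin n} (hik : i < k) (hlt : ¬ blackVertex π i < blackVertex π k)
    (a : Ascent π)
    (h : (whiteVertex π a < blackVertex π i ∧ whiteVertex π a < blackVertex π k) ∨
      (blackVertex π i < whiteVertex π a ∧ blackVertex π k < whiteVertex π a)) :
    lineSlope (white π a) (black π i) ≠ lineSlope (white π a) (black π k) := by
  have h1 : word π ((k : ℕ) + 1) + 1 ≤ word π ((i : ℕ) + 1) := by
    by_contra h2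
    refine hlt (lt_of_le_of_ne ((black_le_black π i k).2 ⟨hik.le, by omega⟩) fun e => ?_)
    have h3 := (black_le_black π k i).1 e.ge
    exact absurd h3.1 (not_le_of_gt hik)
  have h2 : (i : ℕ) + 1 ≤ k := hik
  simp only [white_lt_black, black_lt_white, Nat.lt_iff_add_one_le] at h
  simp only [lineSlope, white, black]
  rify at h h1 h2
  push_cast
  intro heq
  rcases h with ⟨⟨h3, h4⟩, h5, h6⟩ | ⟨⟨h3, h4⟩, h5, h6⟩
  · rw [div_eq_div_iff (by linarith) (by linarith)] at heq
    nlinarith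
  · rw [div_eq_div_iff (by linarith) (by linarith)] at heq
    nlinarith

theorem clockwiseKey_injOn (hπ : IsBaxter π) (d d' : Fin n × Bool)
    (ho : originOf π hπ d = originOf π hπ d') (hk : clockwiseKey π hπ d = clockwiseKey π hπ d') :
    d = d' := by
  obtain ⟨i, b⟩ := d
  obtain ⟨k, c⟩ := d'
  have hk' := congrArg ofLex hk
  simp only [clockwiseKey, ofLex_toLex, Prod.mk.injEq, neg_inj] at hk'
  obtain ⟨hb, hs⟩ := hk'
  have hbc : b = c := by cases b <;> cases c <;> simp_all
  subst hbc
  rw [← ho] at hs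
  suffices ∀ i k : Fin n, originOf π hπ (i, b) = originOf π hπ (k, b) → i < k →
      lineSlope (white π (originOf π hπ (i, b))) (black π i) ≠
        lineSlope (white π (originOf π hπ (i, b))) (black π k) by
    rcases lt_trichotomy i k with h | h | h
    · exact absurd hs (this i k ho h)
    · rw [h]
    · rw [ho] at hs
      exact absurd hs.symm (this k i ho.symm h)
  clear hs hb ho hk i k
  intro i k ho hik
  cases b
  · simp only [originOf, Bool.false_eq_true, if_false] at ho ⊢
    exact slope_ne π hik (not_black_lt_of_same_head π hπ ho) _
      (Or.inr ⟨((black_covBy_iff π hπ i _).2 rfl).1, ho ▸ ((black_covBy_iff π hπ k _).2 rfl).1⟩)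
  · simp only [originOf, if_true] at ho ⊢
    exact slope_ne π hik (not_black_lt_of_same_tail π hπ ho) _
      (Or.inl ⟨((covBy_black_iff π hπ i _).2 rfl).1, ho ▸ ((covBy_black_iff π hπ k _).2 rfl).1⟩)

/-- The underlying oriented map of `Φ(π)`, drawn as in `φ(π)`: its vertices are the white vertices
of `φ(π)`, and its edges correspond to the black vertices of `φ(π)`, which are erased. -/
noncomputable def PhiMap (hπ : IsBaxter π) : OrientedMap where
  V := Ascent π
  E := Fin n
  tail := tailOf π hπ
  head := headOf π hπ
  cw := rotation (originOf π hπ) (clockwiseKey π hπ) (clockwiseKey_injOn π hπ)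
  cw_sameCycle := rotation_sameCycle _ _ (clockwiseKey_injOn π hπ)

/-- `Φ(π)`. Its outer face is the one on the left of the first (leftmost) edge that
starts from the source `w_0`, as the whole drawing lies to the North-East of `w_0`. -/
noncomputable def Phi (hπ : IsBaxter π) : PlaneOrientedMap where
  toOrientedMap := PhiMap π hπ
  IsOuter f := ∃ e : Fin n, (tailOf π hπ e).1 = 0 ∧
    (∀ e' : Fin n, (tailOf π hπ e').1 = 0 →
      clockwiseKey π hπ (e, true) ≤ clockwiseKey π hπ (e', true)) ∧
    f = (PhiMap π hπ).leftFace e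

end Hasse

end BaxterBipolar

/-! The proof replaces the drawing by nearest greater and smaller letters of the word `π(0) π(1) …
π(n+1)`. Call edge `i` the edge given by the point at position `i`, and vertex `a` the white point
of the ascent `a`. The Baxter condition makes edge `i` start at the last earlier position with a
smaller letter (`prevSmaller_tailOf`) and end at the vertex just before the first later position
with a greater letter (`nextGreater_headOf`). Edges that share a tail, or share a head, have
decreasing letters from left to right, so the clockwise order around a vertex depends on positions
only: outgoing edges from left to right, then ingoing edges from right to left.

It follows that the inner faces are the descents `d` of `π`. The left border of the face `d`
consists of the edges whose next smaller letter is at `d + 1`, and its right border of those whose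
previous greater letter is at `d`. Its source is the tail of edge `d + 1`, its sink the head of edge
`d`. A left vertex is a vertex `v` such that edge `v` is on the left border, a right vertex one such
that edge `v + 1` is on the right border. A piece is thus a set of four conditions on the word
(`IsRightPiece`, `IsLeftPiece`).

The four positions read off a piece form the pattern (`IsRightPiece.is2413`, `IsLeftPiece.is3142`).
Conversely, in an occurrence whose two middle positions are as close as possible, every letter
strictly between them has a value between those of the letters 2 and 3. The Baxter condition then
allows the outer letters to be replaced by nearest ones, which yields a piece
(`exists_isRightPiece`, `exists_isLeftPiece`). -/

namespace BaxterBipolar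

/-! ## Nearest greater and smaller letters of a word -/

section Word

/-- `a + 1` is the first position after `i` with a greater letter. -/
def NextGreater (w : ℕ → ℕ) (i a : ℕ) : Prop :=
  i ≤ a ∧ (∀ x, i < x → x ≤ a → w x < w i) ∧ w i < w (a + 1)

/-- `a` is the last position before `i` with a smaller letter. -/
def PrevSmaller (w : ℕ → ℕ) (i a : ℕ) : Prop :=
  a < i ∧ (∀ x, a < x → x < i → w i < w x) ∧ w a < w i

/-- `d + 1` is the first position after `i` with a smaller letter, or `d = n` if all the positions
between `i` and `n` have a greater letter. -/
def NextSmaller (n : ℕ) (w : ℕ → ℕ) (i d : ℕ) : Prop :=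
  i ≤ d ∧ d ≤ n ∧ (∀ x, i < x → x ≤ d → w i < w x) ∧ (d = n ∨ w (d + 1) < w i)

/-- `d` is the last position before `i` with a greater letter, or `d = 0` if all the positions
between `0` and `i` have a smaller letter. -/
def PrevGreater (w : ℕ → ℕ) (i d : ℕ) : Prop :=
  d < i ∧ (∀ x, d < x → x < i → w x < w i) ∧ (d = 0 ∨ w i < w d)

/-- The letters of `w` between the positions `0` and `n + 1` are distinct, the first one is the
smallest and the last one is the greatest. -/
structure IsBordered (n : ℕ) (w : ℕ → ℕ) : Prop where
  inj : ∀ i k, i ≤ n + 1 → k ≤ n + 1 → w i = w k → i = k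
  zero_lt : ∀ i, 0 < i → i ≤ n + 1 → w 0 < w i
  lt_last : ∀ i, i ≤ n → w i < w (n + 1)

variable {n : ℕ} {w : ℕ → ℕ} {a b d i : ℕ}

theorem IsBordered.ne (hw : IsBordered n w) {i k : ℕ} (hi : i ≤ n + 1) (hk : k ≤ n + 1)
    (h : i ≠ k) : w i ≠ w k := fun e => h (hw.inj i k hi hk e)

theorem NextGreater.unique (ha : NextGreater w i a) (hb : NextGreater w i b) : a = b := by
  obtain ⟨h1, h2, h3⟩ := ha
  obtain ⟨h4, h5, h6⟩ := hb
  rcases lt_trichotomy a b with h | h | h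
  · have := h5 (a + 1) (by omega) (by omega); omega
  · exact h
  · have := h2 (b + 1) (by omega) (by omega); omega

theorem PrevSmaller.unique (ha : PrevSmaller w i a) (hb : PrevSmaller w i b) : a = b := by
  obtain ⟨h1, h2, h3⟩ := ha
  obtain ⟨h4, h5, h6⟩ := hb
  rcases lt_trichotomy a b with h | h | h
  · have := h2 b (by omega) (by omega); omega
  · exact h
  · have := h5 a (by omega) (by omega); omega

theorem IsBordered.exists_nextGreater (hw : IsBordered n w) (hi : i ≤ n) :
    ∃ a ≤ n, NextGreater w i a := by
  classical
  have h := hw.lt_last i hi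
  have hex : ∃ a, i ≤ a ∧ w i < w (a + 1) := ⟨n, hi, h⟩
  have hle : Nat.find hex ≤ n := Nat.find_min' hex ⟨hi, h⟩
  refine ⟨Nat.find hex, hle, (Nat.find_spec hex).1, fun x h1 h2 => ?_, (Nat.find_spec hex).2⟩
  have h3 := Nat.find_min hex (m := x - 1) (by omega)
  rw [show x - 1 + 1 = x by omega] at h3
  have h4 := hw.ne (i := x) (k := i) (by omega) (by omega) (by omega)
  omega

theorem IsBordered.exists_prevSmaller (hw : IsBordered n w) (hi : i ≤ n + 1) (h0 : 0 < i) :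
    ∃ a, PrevSmaller w i a := by
  classical
  have h := hw.zero_lt i h0 hi
  -- The search runs backwards from `i - 1`; the witness `i` stands for position `0` by truncated
  -- subtraction.
  have hex : ∃ a, w (i - 1 - a) < w i := ⟨i, by rwa [show i - 1 - i = 0 by omega]⟩
  refine ⟨i - 1 - Nat.find hex, by omega, fun x h1 h2 => ?_, Nat.find_spec hex⟩
  have h3 := Nat.find_min hex (m := i - 1 - x) (by omega)
  rw [show i - 1 - (i - 1 - x) = x by omega] at h3
  have h4 := hw.ne (i := x) (k := i) (by omega) (by omega) (by omega)
  omega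

theorem IsBordered.exists_nextSmaller (hw : IsBordered n w) (hi : i ≤ n) : ∃ d, NextSmaller n w i d := by
  classical
  have hex : ∃ d, i ≤ d ∧ (d = n ∨ w (d + 1) < w i) := ⟨n, hi, Or.inl rfl⟩
  have hle : Nat.find hex ≤ n := Nat.find_min' hex ⟨hi, Or.inl rfl⟩
  refine ⟨Nat.find hex, (Nat.find_spec hex).1, hle, fun x h1 h2 => ?_, (Nat.find_spec hex).2⟩
  have h3 := Nat.find_min hex (m := x - 1) (by omega)
  rw [show x - 1 + 1 = x by omega] at h3
  have h4 := hw.ne (i := x) (k := i) (by omega) (by omega) (by omega)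
  omega

theorem IsBordered.exists_prevGreater (hw : IsBordered n w) (hi : i ≤ n + 1) (h0 : 0 < i) : ∃ d, PrevGreater w i d := by
  classical
  have hex : ∃ a, i - 1 - a = 0 ∨ w i < w (i - 1 - a) := ⟨i, by left; omega⟩
  refine ⟨i - 1 - Nat.find hex, by omega, fun x h1 h2 => ?_, Nat.find_spec hex⟩
  have h3 := Nat.find_min hex (m := i - 1 - x) (by omega)
  rw [show i - 1 - (i - 1 - x) = x by omega] at h3
  have h4 := hw.ne (i := x) (k := i) (by omega) (by omega) (by omega)
  omega

/-- Since `w a ≤ w i < w (a + 1)`, the index `a` is an ascent. Hence edge `a + 1` leaves the vertex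
at which edge `i` ends; `PrevSmaller.nextGreater_self` is the dual fact that edge `a` enters the
vertex at which edge `i` starts. -/
theorem NextGreater.prevSmaller_succ (h : NextGreater w i a) : PrevSmaller w (a + 1) a := by
  obtain ⟨h1, h2, h3⟩ := h
  refine ⟨by omega, fun x _ _ => by omega, ?_⟩
  rcases h1.eq_or_lt with rfl | h1
  · exact h3
  · have := h2 a h1 le_rfl; omega

theorem PrevSmaller.nextGreater_self (h : PrevSmaller w i a) : NextGreater w a a := by
  obtain ⟨h1, h2, h3⟩ := h
  refine ⟨le_rfl, fun x _ _ => by omega, ?_⟩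
  rcases (show a + 1 ≤ i from h1).eq_or_lt with rfl | h4
  · exact h3
  · have := h2 (a + 1) (by omega) h4; omega

/-- Two consecutive edges on the left border of the face `d`. -/
theorem NextSmaller.prevSmaller_cases (hw : IsBordered n w) (h : NextSmaller n w i d)
    (ha : PrevSmaller w i a) :
    (d < n ∧ PrevSmaller w (d + 1) a) ∨ (1 ≤ a ∧ NextSmaller n w a d) ∨ (d = n ∧ a = 0) := by
  obtain ⟨h1, h2, h3, h4⟩ := h
  obtain ⟨h5, h6, h7⟩ := ha
  -- The letter at `i` is the smallest on `(a, d]`, so only `w a` and `w (d + 1)` remain to be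
  -- compared. If `w a` is smaller, `a` is the source of the face; otherwise edge `a` lies just
  -- below edge `i` on the border. The last case is the outer face at the source of the map.
  have key : ∀ x, a < x → x ≤ d → w i ≤ w x := by
    intro x hx hx'
    rcases lt_trichotomy x i with hlt | rfl | hlt
    · exact (h6 x hx hlt).le
    · exact le_rfl
    · exact (h3 x hlt hx').le
  by_cases hd : d = n
  · by_cases ha : a = 0
    · exact Or.inr (Or.inr ⟨hd, ha⟩)
    · refine Or.inr (Or.inl ⟨by omega, by omega, h2, fun x hx hx' => ?_, Or.inl hd⟩)
      have := key x hx hx'; omega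
  · have h4 : w (d + 1) < w i := by omega
    by_cases hlt : w a < w (d + 1)
    · refine Or.inl ⟨by omega, by omega, fun x hx hx' => ?_, hlt⟩
      have := key x hx (by omega); omega
    · have hne := hw.ne (i := a) (k := d + 1) (by omega) (by omega) (by omega)
      have ha : a ≠ 0 := by
        rintro rfl
        have := hw.zero_lt (d + 1) (by omega) (by omega); omega
      refine Or.inr (Or.inl ⟨by omega, by omega, h2, fun x hx hx' => ?_, Or.inr (by omega)⟩)
      have := key x hx hx'; omega

/-- Two consecutive edges on the right border of the face `d`. -/
theorem PrevGreater.nextGreater_cases (hw : IsBordered n w) (h : PrevGreater w i d)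
    (ha : NextGreater w i a) (han : a ≤ n) :
    (1 ≤ d ∧ NextGreater w d a) ∨ (a < n ∧ PrevGreater w (a + 1) d) ∨ (d = 0 ∧ a = n) := by
  obtain ⟨h1, h2, h3⟩ := h
  obtain ⟨h5, h6, h7⟩ := ha
  have key : ∀ x, d < x → x ≤ a → w x ≤ w i := by
    intro x hx hx'
    rcases lt_trichotomy x i with hlt | rfl | hlt
    · exact (h2 x hx hlt).le
    · exact le_rfl
    · exact (h6 x hlt hx').le
  by_cases hd : d = 0
  · by_cases ha : a = n
    · exact Or.inr (Or.inr ⟨hd, ha⟩)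
    · refine Or.inr (Or.inl ⟨by omega, by omega, fun x hx hx' => ?_, Or.inl hd⟩)
      have := key x hx (by omega); omega
  · have h3 : w i < w d := by omega
    by_cases hlt : w d < w (a + 1)
    · refine Or.inl ⟨by omega, by omega, fun x hx hx' => ?_, hlt⟩
      have := key x hx (by omega); omega
    · have hne := hw.ne (i := d) (k := a + 1) (by omega) (by omega) (by omega)
      have ha : a ≠ n := by
        rintro rfl
        have := hw.lt_last d (by omega); omega
      refine Or.inr (Or.inl ⟨by omega, by omega, fun x hx hx' => ?_, Or.inr (by omega)⟩)
      have := key x hx (by omega); omega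

/-- This and the next lemma show that no edge of the left or right border leaves the sink of the
face; the two after them show that none enters its source. -/
theorem NextSmaller.not_prevSmaller_sink (h : NextSmaller n w i d) (hv : NextGreater w d a) :
    ¬ PrevSmaller w i a := fun ha => by
  have := h.1; have := hv.1; have := ha.1; omega

theorem PrevGreater.not_prevSmaller_sink (h : PrevGreater w i d) (hd : 1 ≤ d)
    (hv : NextGreater w d a) : ¬ PrevSmaller w i a := fun ha => by
  obtain ⟨h1, h2, h3⟩ := h
  obtain ⟨h4, h5, h6⟩ := hv
  have h7 := ha.1
  rcases (show a + 1 ≤ i from h7).eq_or_lt with rfl | h8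
  · omega
  · have := h2 (a + 1) (by omega) h8; omega

theorem PrevGreater.not_nextGreater_source (h : PrevGreater w i d)
    (hv : PrevSmaller w (d + 1) a) : ¬ NextGreater w i a := fun ha => by
  have := h.1; have := hv.1; have := ha.1; omega

theorem NextSmaller.not_nextGreater_source (h : NextSmaller n w i d) (hd : d < n)
    (hv : PrevSmaller w (d + 1) a) : ¬ NextGreater w i a := fun ha => by
  obtain ⟨h1, h1', h2, h3⟩ := h
  obtain ⟨h4, h5, h6⟩ := hv
  have h7 := ha.1
  rcases h7.eq_or_lt with rfl | h8
  · omega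
  · have := h2 a h8 (by omega); omega

theorem exists_minimal_letter (hw : IsBordered n w) (had : a < d) (hd : d ≤ n + 1) :
    ∃ i, a < i ∧ i ≤ d ∧ ∀ x, a < x → x ≤ d → x ≠ i → w i < w x := by
  obtain ⟨i, hi, hmin⟩ := Finset.exists_min_image (Finset.Ioc a d) w ⟨d, by simp [had]⟩
  simp only [Finset.mem_Ioc] at hi hmin
  exact ⟨i, hi.1, hi.2, fun x h1 h2 h3 => lt_of_le_of_ne (hmin x ⟨h1, h2⟩)
    (hw.ne (by omega) (by omega) h3.symm)⟩

theorem exists_maximal_letter (hw : IsBordered n w) (had : a < d) (hd : d ≤ n + 1) :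
    ∃ i, a < i ∧ i ≤ d ∧ ∀ x, a < x → x ≤ d → x ≠ i → w x < w i := by
  obtain ⟨i, hi, hmax⟩ := Finset.exists_max_image (Finset.Ioc a d) w ⟨d, by simp [had]⟩
  simp only [Finset.mem_Ioc] at hi hmax
  exact ⟨i, hi.1, hi.2, fun x h1 h2 h3 => lt_of_le_of_ne (hmax x ⟨h1, h2⟩)
    (hw.ne (by omega) (by omega) h3)⟩

/-- An edge on the left border of the face `d` that does not end at the sink. -/
theorem NextSmaller.exists_next (hw : IsBordered n w) (h : NextSmaller n w i d) (hd : d < n)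
    (ha : NextGreater w i a) (hna : ¬ NextGreater w d a) :
    i = a ∧ ∃ k, 1 ≤ k ∧ k ≤ n ∧ PrevSmaller w k a ∧ NextSmaller n w k d := by
  obtain ⟨h1, h2, h3, h4⟩ := h
  have hid : i < d := lt_of_le_of_ne h1 (by rintro rfl; exact hna ha)
  obtain ⟨h5, h6, h7⟩ := ha
  -- Otherwise the letter at `i + 1` would be both greater and smaller than the one at `i`.
  have hia : i = a := by
    by_contra hne
    have := h3 (i + 1) (by omega) (by omega)
    have := h6 (i + 1) (by omega) (by omega)
    omega
  subst hia
  -- The following border edge carries the smallest letter on `(i, d]`.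
  obtain ⟨k, hk1, hk2, hk⟩ := exists_minimal_letter hw hid (by omega)
  have hik := h3 k hk1 hk2
  refine ⟨rfl, k, by omega, by omega, ⟨hk1, fun x hx hx' => hk x hx (by omega) (by omega), hik⟩,
    hk2, h2, fun x hx hx' => hk x (by omega) hx' (by omega), Or.inr (by omega)⟩

/-- An edge on the right border of the face `d` that does not start at the source. -/
theorem PrevGreater.exists_prev (hw : IsBordered n w) (h : PrevGreater w i d) (hd : 1 ≤ d)
    (hin : i ≤ n) (ha : PrevSmaller w i a) (hna : ¬ PrevSmaller w (d + 1) a) :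
    i = a + 1 ∧ ∃ k, 1 ≤ k ∧ k ≤ n ∧ NextGreater w k a ∧ PrevGreater w k d := by
  obtain ⟨h1, h2, h3⟩ := h
  have hid : d + 1 < i := lt_of_le_of_ne h1 (by rintro rfl; exact hna ha)
  obtain ⟨h5, h6, h7⟩ := ha
  have hia : i = a + 1 := by
    by_contra hne
    have := h2 (i - 1) (by omega) (by omega)
    have := h6 (i - 1) (by omega) (by omega)
    omega
  subst hia
  obtain ⟨k, hk1, hk2, hk⟩ := exists_maximal_letter hw (show d < a by omega) (by omega)
  have hik := h2 k hk1 (by omega)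
  refine ⟨rfl, k, by omega, by omega, ⟨hk2, fun x hx hx' => hk x (by omega) hx' (by omega), hik⟩,
    hk1, fun x hx hx' => hk x hx (by omega) (by omega), Or.inr (by omega)⟩

/-! ## Patterns in Baxter words -/

/-- The positions `p < q < r < s` form an occurrence of `2413`. -/
def Is2413 (n : ℕ) (w : ℕ → ℕ) (p q r s : ℕ) : Prop :=
  1 ≤ p ∧ p < q ∧ q < r ∧ r < s ∧ s ≤ n ∧ w r < w p ∧ w p < w s ∧ w s < w q

/-- The positions `p < q < r < s` form an occurrence of `3142`. -/
def Is3142 (n : ℕ) (w : ℕ → ℕ) (p q r s : ℕ) : Prop :=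
  1 ≤ p ∧ p < q ∧ q < r ∧ r < s ∧ s ≤ n ∧ w q < w s ∧ w s < w p ∧ w p < w r

/-- Conditions on the positions of two vertices and two inner faces that form a right-oriented
piece. -/
def IsRightPiece (n : ℕ) (w : ℕ → ℕ) (v₁ v₂ d₁ d₂ : ℕ) : Prop :=
  1 ≤ v₁ ∧ v₂ < n ∧ 1 ≤ d₁ ∧ d₂ < n ∧ PrevSmaller w (d₁ + 1) v₁ ∧ NextSmaller n w v₁ d₂ ∧
    NextGreater w d₂ v₂ ∧ PrevGreater w (v₂ + 1) d₁

/-- Conditions on the positions of two vertices and two inner faces that form a left-oriented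
piece. -/
def IsLeftPiece (n : ℕ) (w : ℕ → ℕ) (v₁ v₂ d₁ d₂ : ℕ) : Prop :=
  1 ≤ d₂ ∧ d₁ < n ∧ PrevSmaller w (d₁ + 1) v₁ ∧ PrevGreater w (v₁ + 1) d₂ ∧
    NextGreater w d₂ v₂ ∧ NextSmaller n w v₂ d₁

/-- The main point is `d₁ < d₂`: otherwise `d₂ + 1` lies in `(v₁, d₁ + 1]`, where all letters exceed
`w v₁`, whereas `w (d₂ + 1) < w v₁`. Then `d₁ + 1` lies between `d₁` and `v₂ + 1`, and its letter
separates the letters 2 and 3. -/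
theorem IsRightPiece.is2413 {v₁ v₂ d₁ d₂ : ℕ} (h : IsRightPiece n w v₁ v₂ d₁ d₂) :
    Is2413 n w v₁ d₁ (d₂ + 1) (v₂ + 1) := by
  obtain ⟨hv₁, hv₂, hd₁, hd₂, ⟨a1, a2, a3⟩, ⟨b1, b2, b3, b4⟩, ⟨c1, c2, c3⟩, e1, e2, e3⟩ := h
  have h1 : d₁ < d₂ := by
    by_contra hle
    rcases (not_lt.1 hle).eq_or_lt with rfl | hlt
    · omega
    · have := a2 (d₂ + 1) (by omega) (by omega); omega
  have h2 := e2 (d₁ + 1) (by omega) (by omega)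
  have h3 : v₁ ≠ d₁ := by rintro rfl; omega
  have h4 : d₂ ≠ v₂ := by
    rintro rfl
    have := b3 d₂ (by omega) le_rfl; omega
  refine ⟨hv₁, ?_, ?_, ?_, ?_, ?_, ?_, ?_⟩ <;> omega

theorem IsLeftPiece.is3142 {v₁ v₂ d₁ d₂ : ℕ} (h : IsLeftPiece n w v₁ v₂ d₁ d₂) :
    Is3142 n w d₂ v₁ (v₂ + 1) (d₁ + 1) := by
  obtain ⟨hd₂, hd₁, ⟨a1, a2, a3⟩, ⟨b1, b2, b3⟩, ⟨c1, c2, c3⟩, e1, e2, e3, e4⟩ := h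
  have h1 : v₁ < v₂ := by
    by_contra hle
    rcases (not_lt.1 hle).eq_or_lt with rfl | hlt
    · omega
    · have := e3 v₁ hlt (by omega); omega
  have h2 := c2 (v₁ + 1) (by omega) (by omega)
  have h3 : w v₂ ≤ w d₂ := by
    rcases c1.eq_or_lt with rfl | h
    · exact le_rfl
    · exact (c2 v₂ h le_rfl).le
  have h4 : d₂ ≠ v₁ := by
    rintro rfl
    have := a2 (d₂ + 1) (by omega)
    omega
  have h5 : v₂ ≠ d₁ := by
    rintro rfl
    have := a2 v₂ (by omega) (by omega); omega
  refine ⟨hd₂, ?_, ?_, ?_, ?_, ?_, ?_, ?_⟩ <;> omega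

/-- The Baxter condition for a word. -/
def IsBaxterWord (n : ℕ) (w : ℕ → ℕ) : Prop :=
  ∀ i j k : ℕ, i < j → j < k → k ≤ n + 1 →
    ¬ (w (j + 1) < w i ∧ w i < w k ∧ w k < w j) ∧ ¬ (w j < w k ∧ w k < w i ∧ w i < w (j + 1))

/-- The quantity minimised is the distance between the two middle positions; `P` is either pattern.
-/
theorem exists_minimal_occurrence {P : ℕ → ℕ → ℕ → ℕ → Prop} (h : ∃ p q r s, P p q r s) :
    ∃ p q r s, P p q r s ∧ ∀ p' q' r' s', P p' q' r' s' → r - q ≤ r' - q' := by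
  classical
  have hex : ∃ g p q r s, P p q r s ∧ r - q = g := by
    obtain ⟨p, q, r, s, h⟩ := h
    exact ⟨_, p, q, r, s, h, rfl⟩
  obtain ⟨p, q, r, s, h, hg⟩ := Nat.find_spec hex
  exact ⟨p, q, r, s, h, fun p' q' r' s' h' =>
    hg ▸ Nat.find_min' hex ⟨p', q', r', s', h', rfl⟩⟩

/-- The middle positions `q` and `r = d + 1` of a tightest occurrence provide the two faces `q` and
`d`; the source of the first and the sink of the second are the two vertices. -/
theorem exists_isRightPiece (hw : IsBordered n w) (hb : IsBaxterWord n w)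
    (h : ∃ p q r s, Is2413 n w p q r s) : ∃ v₁ v₂ d₁ d₂, IsRightPiece n w v₁ v₂ d₁ d₂ := by
  obtain ⟨p, q, r, s, h, hmin⟩ := exists_minimal_occurrence h
  -- the letters between `q` and `r` are between the letters `2` and `3` of any occurrence
  have hbetween : ∀ p' s', Is2413 n w p' q r s' → ∀ x, q < x → x < r → w p' < w x ∧ w x < w s' := by
    rintro p' s' ⟨h1, h2, h3, h4, h5, h6, h7, h8⟩ x hx hx'
    have n1 := hw.ne (i := p') (k := x) (by omega) (by omega) (by omega)
    have n2 := hw.ne (i := s') (k := x) (by omega) (by omega) (by omega)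
    constructor
    -- A letter below the letter 2 could replace the letter 1, and one above the letter 3 could
    -- replace the letter 4, giving closer middle positions.
    · by_contra hlt
      have := hmin p' q x s' ⟨h1, by omega, by omega, by omega, by omega, by omega, by omega, h8⟩
      omega
    · by_contra hlt
      have := hmin p' x r s' ⟨h1, by omega, by omega, by omega, by omega, by omega, by omega,
        by omega⟩
      omega
  have hb0 := hbetween p s h
  obtain ⟨hp, hpq, hqr, hrs, hsn, h1, h2, h3⟩ := h
  obtain ⟨d, rfl⟩ : ∃ d, r = d + 1 := ⟨r - 1, by omega⟩
  -- If the letters 4 and 1 were adjacent, `p`, `q`, `s` would violate the Baxter condition.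
  have hqd : q < d := by
    by_contra hle
    obtain rfl : q = d := by omega
    exact (hb p q s hpq (by omega) (by omega)).1 ⟨h1, h2, h3⟩
  have hbq := hb0 (q + 1) (by omega) (by omega)
  have hbd := hb0 d (by omega) (by omega)
  obtain ⟨a, ha⟩ := hw.exists_prevSmaller (i := q + 1) (by omega) (by omega)
  obtain ⟨c, hcn, hc⟩ := hw.exists_nextGreater (i := d) (by omega)
  obtain ⟨a1, a2, a3⟩ := id ha
  obtain ⟨c1, c2, c3⟩ := id hc
  have hpa : p ≤ a := by
    by_contra hlt
    have := a2 p (by omega) (by omega); omega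
  have haq : a ≠ q := by rintro rfl; omega
  have hcs : c + 1 ≤ s := by
    by_contra hlt
    have := c2 s (by omega) (by omega); omega
  have hdc : d ≠ c := by rintro rfl; omega
  -- Otherwise `w a < w (d + 1) < w p < w (a + 1)` violates the Baxter condition at `p < a < d + 1`.
  have ha4 : w (d + 1) < w a := by
    by_contra hlt
    have n1 := hw.ne (i := d + 1) (k := a) (by omega) (by omega) (by omega)
    have h5 := a2 (a + 1) (by omega)
    have hpa' : p ≠ a := by rintro rfl; omega
    have h6 : w p < w (a + 1) := by
      rcases (show a + 1 ≤ q by omega).eq_or_lt with h | h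
      · rw [h]; omega
      · have := h5 (by omega); omega
    exact (hb p a (d + 1) (by omega) (by omega) (by omega)).2 ⟨by omega, by omega, h6⟩
  -- Otherwise `w c < w s < w q < w (c + 1)` violates the Baxter condition at `q < c < s`.
  have hc4 : w (c + 1) < w q := by
    by_contra hlt
    have n1 := hw.ne (i := c + 1) (k := q) (by omega) (by omega) (by omega)
    have h5 := c2 c (by omega) le_rfl
    have hcs' : c + 1 ≠ s := by rintro rfl; omega
    exact (hb q c s (by omega) (by omega) (by omega)).2 ⟨by omega, by omega, by omega⟩
  -- Minimality is used again after replacing `p` by `a`, then `s` by `c + 1`: the middle positions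
  -- are unchanged, and the letters between them get the sharper bounds required by the piece.
  have had := (hbetween a s ⟨by omega, by omega, by omega, by omega, by omega, ha4,
    by omega, h3⟩ d (by omega) (by omega)).1
  have hac := hbetween a (c + 1) ⟨by omega, by omega, by omega, by omega, by omega, ha4,
    by omega, hc4⟩
  refine ⟨a, c, q, d, by omega, by omega, by omega, by omega, ha,
    ⟨by omega, by omega, fun x hx hx' => ?_, Or.inr ha4⟩, hc, by omega, fun x hx hx' => ?_,
    Or.inr hc4⟩
  · rcases lt_trichotomy x q with h | rfl | h
    · have := a2 x hx (by omega); omega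
    · omega
    · exact (hac x h (by omega)).1
  · rcases le_or_gt x d with h | h
    · exact (hac x hx (by omega)).2
    · have := c2 x h (by omega); omega

/-- The roles are exchanged with respect to `exists_isRightPiece`: the middle positions `q` and `r =
c + 1` provide the vertices `q` and `c`, and the nearest greater or smaller letters provide the
faces. -/
theorem exists_isLeftPiece (hw : IsBordered n w) (hb : IsBaxterWord n w)
    (h : ∃ p q r s, Is3142 n w p q r s) : ∃ v₁ v₂ d₁ d₂, IsLeftPiece n w v₁ v₂ d₁ d₂ := by
  obtain ⟨p, q, r, s, h, hmin⟩ := exists_minimal_occurrence h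
  -- the letters between `q` and `r` are between the letters `2` and `3` of any occurrence
  have hbetween : ∀ p' s', Is3142 n w p' q r s' → ∀ x, q < x → x < r → w s' < w x ∧ w x < w p' := by
    rintro p' s' ⟨h1, h2, h3, h4, h5, h6, h7, h8⟩ x hx hx'
    have n1 := hw.ne (i := p') (k := x) (by omega) (by omega) (by omega)
    have n2 := hw.ne (i := s') (k := x) (by omega) (by omega) (by omega)
    constructor
    · by_contra hlt
      have := hmin p' x r s' ⟨h1, by omega, by omega, by omega, by omega, by omega, by omega, h8⟩
      omega
    · by_contra hlt
      have := hmin p' q x s' ⟨h1, by omega, by omega, by omega, by omega, by omega, by omega,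
        by omega⟩
      omega
  have hb0 := hbetween p s h
  obtain ⟨hp, hpq, hqr, hrs, hsn, h1, h2, h3⟩ := h
  obtain ⟨c, rfl⟩ : ∃ c, r = c + 1 := ⟨r - 1, by omega⟩
  have hqc : q < c := by
    by_contra hle
    obtain rfl : q = c := by omega
    exact (hb p q s hpq (by omega) (by omega)).2 ⟨h1, h2, h3⟩
  have hbq := hb0 (q + 1) (by omega) (by omega)
  have hbc := hb0 c (by omega) (by omega)
  obtain ⟨e, he⟩ := hw.exists_prevGreater (i := q + 1) (by omega) (by omega)
  obtain ⟨d, hd⟩ := hw.exists_nextSmaller (i := c) (by omega)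
  obtain ⟨e1, e2, e3⟩ := id he
  obtain ⟨d1, d2, d3, d4⟩ := id hd
  have hpe : p ≤ e := by
    by_contra hlt
    have := e2 p (by omega) (by omega); omega
  have heq : e ≠ q := by rintro rfl; omega
  have hds : d + 1 ≤ s := by
    by_contra hlt
    have := d3 s (by omega) (by omega); omega
  have hcd : c ≠ d := by rintro rfl; omega
  -- Otherwise `w (e + 1) < w p < w (c + 1) < w e` violates the Baxter condition at `p < e < c + 1`.
  have he4 : w e < w (c + 1) := by
    by_contra hlt
    have n1 := hw.ne (i := c + 1) (k := e) (by omega) (by omega) (by omega)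
    have h5 := e2 (e + 1) (by omega)
    have hpe' : p ≠ e := by rintro rfl; omega
    have h6 : w (e + 1) < w p := by
      rcases (show e + 1 ≤ q by omega).eq_or_lt with h | h
      · rw [h]; omega
      · have := h5 (by omega); omega
    exact (hb p e (c + 1) (by omega) (by omega) (by omega)).1 ⟨h6, by omega, by omega⟩
  -- Otherwise `w (d + 1) < w q < w s < w d` violates the Baxter condition at `q < d < s`.
  have hd4 : w q < w (d + 1) := by
    by_contra hlt
    have n1 := hw.ne (i := d + 1) (k := q) (by omega) (by omega) (by omega)
    have h5 := d3 d (by omega) le_rfl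
    have hds' : d + 1 ≠ s := by rintro rfl; omega
    exact (hb q d s (by omega) (by omega) (by omega)).1 ⟨by omega, by omega, by omega⟩
  have hec := (hbetween e s ⟨by omega, by omega, by omega, by omega, by omega, h1,
    by omega, he4⟩ c (by omega) (by omega)).2
  have hde := hbetween e (d + 1) ⟨by omega, by omega, by omega, by omega, by omega, hd4,
    by omega, he4⟩
  refine ⟨q, c, d, e, by omega, by omega, ⟨by omega, fun x hx hx' => ?_, hd4⟩, he,
    ⟨by omega, fun x hx hx' => ?_, he4⟩, hd⟩
  · rcases le_or_gt x c with h | h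
    · exact (hde x hx (by omega)).1
    · have := d3 x h (by omega); omega
  · rcases le_or_gt x q with h | h
    · have := e2 x hx (by omega); omega
    · exact (hde x h (by omega)).2

end Word
-- Tails, heads and rotation of `Φ(π)` in terms of the word
section Orientation

variable {n : ℕ} (π : Equiv.Perm (Fin n))

theorem isBordered_word : IsBordered n (word π) where
  inj _ _ hi hk h := word_inj π hi hk h
  zero_lt i h0 hi := by
    have h1 : word π i ≠ word π 0 := fun e => by
      have := word_inj π hi (by omega) e; omega
    have h2 : word π 0 = 0 := rfl
    omega
  lt_last i hi := by
    have h1 : word π i ≠ word π (n + 1) := fun e => by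
      have := word_inj π (by omega) le_rfl e; omega
    have h2 := word_le π i
    rw [word_last] at h1 ⊢
    omega

variable (hπ : IsBaxter π)

/-- `tailOf` is chosen by its covering property alone; the vertex given by `exists_greatest_below`
is also covered by the black vertex, hence is the same one. -/
theorem lt_black_iff (i : Fin n) (z : vertexSet π) :
    z < blackVertex π i ↔ z ≤ whiteVertex π (tailOf π hπ i) := by
  obtain ⟨a, ha⟩ := exists_greatest_below π hπ i
  have h : whiteVertex π a = whiteVertex π (tailOf π hπ i) :=
    (covBy_black_iff π hπ i _).1
      ⟨(ha _).2 le_rfl, fun c h1 h2 => absurd ((ha c).1 h2) (not_le_of_gt h1)⟩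
  rw [ha z, h]

theorem black_lt_iff (i : Fin n) (z : vertexSet π) :
    blackVertex π i < z ↔ whiteVertex π (headOf π hπ i) ≤ z := by
  obtain ⟨a, ha⟩ := exists_least_above π hπ i
  have h : whiteVertex π a = whiteVertex π (headOf π hπ i) :=
    (black_covBy_iff π hπ i _).1
      ⟨(ha _).2 le_rfl, fun c h1 h2 => absurd ((ha c).1 h1) (not_le_of_gt h2)⟩
  rw [ha z, h]

theorem nextGreater_headOf (i : Fin n) :
    NextGreater (word π) ((i : ℕ) + 1) (headOf π hπ i).1 := by
  obtain ⟨a, han, ha⟩ := (isBordered_word π).exists_nextGreater (i := (i : ℕ) + 1) (by omega)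
  obtain ⟨h1, h2, h3⟩ := id ha
  have hasc : word π a < word π (a + 1) := ha.prevSmaller_succ.2.2
  have hle := (white_le_white π _ ⟨a, han, hasc⟩).1 ((black_lt_iff π hπ i _).1
    ((black_lt_white π i _).2 ⟨h1, le_ell π h1 h3⟩))
  obtain ⟨h4, h5⟩ := (black_lt_white π i _).1 ((black_lt_iff π hπ i _).2 le_rfl)
  obtain ⟨k, h6, h7, h8⟩ := exists_ell π (headOf π hπ i).2.2
  have h9 : (headOf π hπ i).1 = a := by
    -- A head further left would be followed by a letter smaller than that of the edge, whereas its
    -- ordinate `ell` is at least that letter and below the following one.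
    refine le_antisymm hle.1 ?_
    by_contra hlt
    have := h2 ((headOf π hπ i).1 + 1) (by omega) (by omega)
    omega
  rwa [h9]

theorem prevSmaller_tailOf (i : Fin n) :
    PrevSmaller (word π) ((i : ℕ) + 1) (tailOf π hπ i).1 := by
  obtain ⟨a, ha⟩ := (isBordered_word π).exists_prevSmaller (i := (i : ℕ) + 1) (by omega)
    (by omega)
  obtain ⟨h1, h2, h3⟩ := id ha
  have hasc : word π a < word π (a + 1) := ha.nextGreater_self.2.2
  -- That the white point of `a` lies below the black one is where the Baxter condition enters,
  -- through `ell_lt`.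
  have hle := (white_le_white π ⟨a, by omega, hasc⟩ _).1 ((lt_black_iff π hπ i _).1
    ((white_lt_black π i _).2 ⟨h1, ell_lt π hπ hasc h1 (by omega) h3⟩))
  obtain ⟨h4, h5⟩ := (white_lt_black π i _).1 ((lt_black_iff π hπ i _).2 le_rfl)
  have h6 := le_ell π le_rfl (tailOf π hπ i).2.2
  have h9 : (tailOf π hπ i).1 = a := by
    refine le_antisymm ?_ hle.1
    by_contra hlt
    have := h2 (tailOf π hπ i).1 (by omega) (by omega)
    omega
  rwa [h9]

theorem headOf_eq_iff (i : Fin n) (v : Ascent π) :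
    headOf π hπ i = v ↔ NextGreater (word π) ((i : ℕ) + 1) v.1 :=
  ⟨fun h => h ▸ nextGreater_headOf π hπ i,
    fun h => Subtype.ext ((nextGreater_headOf π hπ i).unique h)⟩

theorem tailOf_eq_iff (i : Fin n) (v : Ascent π) :
    tailOf π hπ i = v ↔ PrevSmaller (word π) ((i : ℕ) + 1) v.1 :=
  ⟨fun h => h ▸ prevSmaller_tailOf π hπ i,
    fun h => Subtype.ext ((prevSmaller_tailOf π hπ i).unique h)⟩

theorem word_lt_of_not_black_lt {i k : Fin n} (hik : i < k)
    (h : ¬ blackVertex π i < blackVertex π k) : word π ((k : ℕ) + 1) < word π ((i : ℕ) + 1) := by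
  by_contra hlt
  refine h (lt_of_le_of_ne ((black_le_black π i k).2 ⟨hik.le, by omega⟩) fun e => ?_)
  exact absurd ((black_le_black π k i).1 e.ge).1 (not_le_of_gt hik)

/-- Black points with a common tail are incomparable, so the one further right is lower and is seen
from the tail under a smaller slope. -/
theorem lineSlope_lt_of_same_tail {i k : Fin n} (hik : i < k)
    (h : tailOf π hπ i = tailOf π hπ k) :
    lineSlope (white π (tailOf π hπ i)) (black π k) <
      lineSlope (white π (tailOf π hπ i)) (black π i) := by
  have h1 := word_lt_of_not_black_lt π hik (not_black_lt_of_same_tail π hπ h)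
  have h2 := (white_lt_black π i _).1 ((lt_black_iff π hπ i _).2 le_rfl)
  have h3 := (white_lt_black π k _).1 ((lt_black_iff π hπ k _).2 le_rfl)
  rw [← h] at h3
  have h4 : (i : ℕ) < k := hik
  simp only [Nat.lt_iff_add_one_le] at h1 h2 h3 h4
  obtain ⟨h5, h6⟩ := h2
  obtain ⟨h7, h8⟩ := h3
  simp only [lineSlope, white, black]
  rify at h1 h4 h5 h6 h7 h8
  push_cast
  rw [div_lt_div_iff₀ (by linarith) (by linarith)]
  nlinarith

theorem lineSlope_lt_of_same_head {i k : Fin n} (hik : i < k)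
    (h : headOf π hπ i = headOf π hπ k) :
    lineSlope (white π (headOf π hπ i)) (black π i) <
      lineSlope (white π (headOf π hπ i)) (black π k) := by
  have h1 := word_lt_of_not_black_lt π hik (not_black_lt_of_same_head π hπ h)
  have h2 := (black_lt_white π i _).1 ((black_lt_iff π hπ i _).2 le_rfl)
  have h3 := (black_lt_white π k _).1 ((black_lt_iff π hπ k _).2 le_rfl)
  rw [← h] at h3
  have h4 : (i : ℕ) < k := hik
  simp only [Nat.lt_iff_add_one_le] at h1 h4
  obtain ⟨h5, h6⟩ := h2
  obtain ⟨h7, h8⟩ := h3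
  simp only [lineSlope, white, black]
  rify at h1 h4 h5 h6 h7 h8
  push_cast
  -- The black points lie South-West of the head; changing signs makes the denominators positive.
  rw [← neg_div_neg_eq, ← neg_div_neg_eq (_ - _ : ℝ), div_lt_div_iff₀ (by linarith) (by linarith)]
  nlinarith

/-- The rank of a half-edge in the clockwise order around its vertex: the outgoing edges from
left to right, then the ingoing edges from right to left. -/
def clockwiseRank (d : Fin n × Bool) : ℕ := if d.2 then d.1 else 2 * n - d.1

/-- Outgoing half-edges have rank below `n` and ingoing ones rank above `n`; within each kind the
slope lemmas compare positions. -/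
theorem clockwiseKey_lt_of_rank_lt {d d' : Fin n × Bool}
    (ho : originOf π hπ d = originOf π hπ d') (h : clockwiseRank d < clockwiseRank d') :
    clockwiseKey π hπ d < clockwiseKey π hπ d' := by
  obtain ⟨i, b⟩ := d
  obtain ⟨k, c⟩ := d'
  have hi := i.2
  have hk := k.2
  rw [clockwiseKey, clockwiseKey, Prod.Lex.toLex_lt_toLex]
  cases b <;> cases c <;> simp only [clockwiseRank, originOf, Bool.false_eq_true, if_true, if_false,
    lt_self_iff_false, false_or, true_and, zero_lt_one, true_or, not_lt_zero, neg_lt_neg_iff]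
    at ho h ⊢
  · rw [ho]
    exact lineSlope_lt_of_same_head π hπ (Fin.lt_def.2 (by omega)) ho.symm
  · omega
  · rw [← ho]
    exact lineSlope_lt_of_same_tail π hπ (Fin.lt_def.2 h) ho

theorem clockwiseRank_inj {d d' : Fin n × Bool} (h : clockwiseRank d = clockwiseRank d') :
    d = d' := by
  obtain ⟨i, b⟩ := d
  obtain ⟨k, c⟩ := d'
  have hi := i.2
  have hk := k.2
  cases b <;> cases c <;> simp [clockwiseRank] at h ⊢ <;> omega

theorem clockwiseKey_le_iff {d d' : Fin n × Bool} (ho : originOf π hπ d = originOf π hπ d') :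
    clockwiseKey π hπ d ≤ clockwiseKey π hπ d' ↔ clockwiseRank d ≤ clockwiseRank d' := by
  refine ⟨fun h => not_lt.1 fun hlt => ?_, fun h => ?_⟩
  · exact absurd h (not_le_of_gt (clockwiseKey_lt_of_rank_lt π hπ ho.symm hlt))
  · rcases h.eq_or_lt with h | h
    · rw [clockwiseRank_inj h]
    · exact (clockwiseKey_lt_of_rank_lt π hπ ho h).le

/-- `IsNext` determines its second argument, and at a given vertex keys and ranks are ordered alike;
the rotation can thus be computed with positions only. -/
theorem cw_eq {d d' : Fin n × Bool} (h : IsNext (originOf π hπ) clockwiseRank d d') :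
    (PhiMap π hπ).cw d = d' := by
  refine IsNext.unique (clockwiseKey_injOn π hπ) (rotation_isNext _ _
    (clockwiseKey_injOn π hπ) d) ?_
  obtain ⟨ho, h⟩ := h
  refine ⟨ho, ?_⟩
  simp only [← not_le] at h ⊢
  refine h.imp (fun h => ⟨?_, fun x hx hdx => ?_⟩) (fun h => ⟨fun x hx => ?_, fun x hx => ?_⟩)
  · rw [clockwiseKey_le_iff π hπ ho]; exact h.1
  · rw [clockwiseKey_le_iff π hπ hx] at hdx
    rw [clockwiseKey_le_iff π hπ (ho.trans hx.symm)]
    exact h.2 x hx hdx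
  · rw [clockwiseKey_le_iff π hπ hx]; exact h.1 x hx
  · rw [clockwiseKey_le_iff π hπ (ho.trans hx.symm)]; exact h.2 x hx

end Orientation
-- The rotation at each kind of corner of a face
section Faces

variable {n : ℕ} (π : Equiv.Perm (Fin n)) (hπ : IsBaxter π)

theorem originOf_true_eq_iff (i : Fin n) (v : Ascent π) :
    originOf π hπ (i, true) = v ↔ PrevSmaller (word π) ((i : ℕ) + 1) v.1 :=
  tailOf_eq_iff π hπ i v

theorem originOf_false_eq_iff (i : Fin n) (v : Ascent π) :
    originOf π hπ (i, false) = v ↔ NextGreater (word π) ((i : ℕ) + 1) v.1 :=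
  headOf_eq_iff π hπ i v

/-- The half-edge `x` is followed along its border of the face `d`. The outer face has
number `0`; it is also on the right of the edges that no smaller letter follows. -/
def HasFace (d : ℕ) (x : Fin n × Bool) : Prop :=
  if x.2 then PrevGreater (word π) ((x.1 : ℕ) + 1) d
  else NextSmaller n (word π) ((x.1 : ℕ) + 1) (if d = 0 then n else d)

theorem exists_hasFace (x : Fin n × Bool) : ∃ d < n, HasFace π d x := by
  obtain ⟨i, b⟩ := x
  cases b
  · obtain ⟨d, hd⟩ := (isBordered_word π).exists_nextSmaller (i := (i : ℕ) + 1) (by omega)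
    have h1 := hd.1
    have h2 := hd.2.1
    rcases h2.eq_or_lt with rfl | h2
    · exact ⟨0, by omega, by simpa [HasFace] using hd⟩
    · exact ⟨d, h2, by simpa [HasFace, show d ≠ 0 by omega] using hd⟩
  · obtain ⟨d, hd⟩ := (isBordered_word π).exists_prevGreater (i := (i : ℕ) + 1) (by omega)
      (by omega)
    exact ⟨d, by have := hd.1; omega, by simpa [HasFace] using hd⟩

variable {π}

/-- An element `i` of `Fin n` stands for position `i + 1`, so `⟨d, hdn⟩` is edge `d + 1`. Letters
between `i + 1` and `d + 1` exceed that of `i + 1`, so none of these edges starts at `a`. This is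
the corner at the source of the face `d`. -/
theorem cw_true_eq_true {i : Fin n} {a d : ℕ} (hd : NextSmaller n (word π) ((i : ℕ) + 1) d)
    (ha : PrevSmaller (word π) ((i : ℕ) + 1) a) (hdn : d < n)
    (hda : PrevSmaller (word π) (d + 1) a) :
    (PhiMap π hπ).cw (i, true) = (⟨d, hdn⟩, true) := by
  have hv := (prevSmaller_tailOf π hπ i).unique ha
  subst hv
  refine cw_eq π hπ ⟨(originOf_true_eq_iff π hπ _ _).2 hda, Or.inl ⟨hd.1, ?_⟩⟩
  rintro ⟨k, c⟩ ho hlt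
  obtain ⟨d1, d2, d3, d4⟩ := hd
  obtain ⟨a1, a2, a3⟩ := ha
  cases c
  · simp only [clockwiseRank, Bool.false_eq_true, if_true, if_false]
    omega
  · obtain ⟨h1, h2, h3⟩ := (originOf_true_eq_iff π hπ _ _).1 ho
    simp only [clockwiseRank, if_true] at hlt ⊢
    by_contra hlt'
    have h4 := h2 _ a1 (by omega)
    have h5 := d3 _ (show (i : ℕ) + 1 < k + 1 by omega) (by omega)
    omega

/-- Corner inside a left border: `i` is the last outgoing edge of the vertex `k + 1`, and the first
ingoing one is the rightmost, at position `k + 1` itself. -/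
theorem cw_true_eq_false {i k : Fin n} {d : ℕ} (hd : NextSmaller n (word π) ((i : ℕ) + 1) d)
    (ha : PrevSmaller (word π) ((i : ℕ) + 1) (k + 1))
    (hda : NextSmaller n (word π) (k + 1) d) :
    (PhiMap π hπ).cw (i, true) = (k, false) := by
  have hv := (prevSmaller_tailOf π hπ i).unique ha
  refine cw_eq π hπ ⟨(originOf_false_eq_iff π hπ _ _).2 ?_, Or.inl ⟨?_, ?_⟩⟩
  · exact hv ▸ ha.nextGreater_self
  · simp only [clockwiseRank, Bool.false_eq_true, if_true, if_false]
    omega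
  rintro ⟨x, c⟩ ho hlt
  obtain ⟨d1, d2, d3, d4⟩ := hd
  obtain ⟨a1, a2, a3⟩ := ha
  obtain ⟨e1, e2, e3, e4⟩ := hda
  cases c
  · obtain ⟨h1, h2, h3⟩ := (originOf_false_eq_iff π hπ _ _).1 ho
    simp only [clockwiseRank, Bool.false_eq_true, if_true, if_false, originOf] at h1 ⊢
    omega
  · obtain ⟨h1, h2, h3⟩ := (originOf_true_eq_iff π hπ _ _).1 ho
    simp only [originOf, if_true, hv] at h1 h2 h3
    simp only [clockwiseRank, if_true] at hlt
    exfalso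
    have h4 := h2 _ a1 (by omega)
    by_cases hxd : (x : ℕ) + 1 ≤ d
    · have := d3 (x + 1) (by omega) hxd; omega
    · rcases (show d + 1 ≤ x + 1 by omega).eq_or_lt with h5 | h5
      · rw [h5] at e4; omega
      · have := h2 (d + 1) (by omega) h5; omega

/-- Outer corner at `w_0`: no edge enters, so the order wraps round to the edge at position `1`. -/
theorem cw_true_eq_first {i : Fin n} (hd : NextSmaller n (word π) ((i : ℕ) + 1) n)
    (ha : PrevSmaller (word π) ((i : ℕ) + 1) 0) (hn : 0 < n) :
    (PhiMap π hπ).cw (i, true) = (⟨0, hn⟩, true) := by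
  have hv := (prevSmaller_tailOf π hπ i).unique ha
  refine cw_eq π hπ ⟨(originOf_true_eq_iff π hπ _ _).2 ?_, Or.inr ⟨?_, ?_⟩⟩
  · show PrevSmaller _ 1 (tailOf π hπ i).1
    rw [hv]
    exact ⟨by omega, fun x _ _ => by omega, (isBordered_word π).zero_lt 1 (by omega) (by omega)⟩
  · rintro ⟨x, c⟩ ho
    cases c
    · have h1 := ((originOf_false_eq_iff π hπ _ _).1 ho).1
      simp only [originOf, if_true, hv] at h1
      omega
    · obtain ⟨h1, h2, h3⟩ := (originOf_true_eq_iff π hπ _ _).1 ho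
      simp only [originOf, if_true, hv] at h1 h2 h3
      simp only [clockwiseRank, if_true]
      by_contra hlt
      have := h2 (i + 1) (by omega) (by omega)
      have := hd.2.2.1 (x + 1) (by omega) (by omega)
      omega
  · intro x _
    exact Nat.zero_le _

/-- Corner at the sink of the face `k + 1`: the next ingoing edge to the left is at the previous
greater letter. -/
theorem cw_false_eq_false {i k : Fin n} {a : ℕ} (hd : PrevGreater (word π) ((i : ℕ) + 1) (k + 1))
    (ha : NextGreater (word π) ((i : ℕ) + 1) a) (hda : NextGreater (word π) (k + 1) a) :
    (PhiMap π hπ).cw (i, false) = (k, false) := by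
  have hv := (nextGreater_headOf π hπ i).unique ha
  subst hv
  refine cw_eq π hπ ⟨(originOf_false_eq_iff π hπ _ _).2 hda, Or.inl ⟨?_, ?_⟩⟩
  · have := hd.1
    simp only [clockwiseRank, Bool.false_eq_true, if_false]
    omega
  rintro ⟨x, c⟩ ho hlt
  obtain ⟨d1, d2, d3⟩ := hd
  obtain ⟨a1, a2, a3⟩ := ha
  cases c
  · obtain ⟨h1, h2, h3⟩ := (originOf_false_eq_iff π hπ _ _).1 ho
    simp only [clockwiseRank, Bool.false_eq_true, if_false] at hlt ⊢
    by_contra hlt'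
    have h4 := h2 (i + 1) (by omega) a1
    have h5 := d2 (x + 1) (by omega) (by omega)
    omega
  · simp only [clockwiseRank, Bool.false_eq_true, if_true, if_false] at hlt
    omega

/-- Corner inside a right border: `i` is the leftmost edge entering the vertex `k`, and the order
wraps round to the leftmost edge leaving it, at position `k + 1`. -/
theorem cw_false_eq_true {i k : Fin n} {d : ℕ} (hd : PrevGreater (word π) ((i : ℕ) + 1) d)
    (ha : NextGreater (word π) ((i : ℕ) + 1) k) (hda : PrevGreater (word π) (k + 1) d) :
    (PhiMap π hπ).cw (i, false) = (k, true) := by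
  have hv := (nextGreater_headOf π hπ i).unique ha
  refine cw_eq π hπ ⟨(originOf_true_eq_iff π hπ _ _).2 ?_, Or.inr ⟨?_, ?_⟩⟩
  · exact hv ▸ ha.prevSmaller_succ
  · rintro ⟨x, c⟩ ho
    obtain ⟨d1, d2, d3⟩ := hd
    obtain ⟨a1, a2, a3⟩ := ha
    obtain ⟨e1, e2, e3⟩ := hda
    cases c
    · obtain ⟨h1, h2, h3⟩ := (originOf_false_eq_iff π hπ _ _).1 ho
      simp only [originOf, Bool.false_eq_true, if_false, hv] at h1 h2 h3
      simp only [clockwiseRank, Bool.false_eq_true, if_false]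
      by_contra hlt
      have h4 := h2 (i + 1) (by omega) a1
      by_cases hxd : d < (x : ℕ) + 1
      · have := d2 (x + 1) hxd (by omega); omega
      · rcases (show x + 1 ≤ d by omega).eq_or_lt with h5 | h5
        · rw [← h5] at e3; omega
        · have := h2 d h5 (by omega); omega
    · simp only [clockwiseRank, Bool.false_eq_true, if_true, if_false]
      omega
  · rintro ⟨x, c⟩ ho
    cases c
    · simp only [clockwiseRank, Bool.false_eq_true, if_true, if_false]
      omega
    · have h1 := ((originOf_true_eq_iff π hπ _ _).1 ho).1
      simp only [originOf, Bool.false_eq_true, if_false, hv] at h1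
      simp only [clockwiseRank, if_true]
      omega

/-- Outer corner at `w_n`: no edge leaves, so the order wraps round to the edge at position `n`. -/
theorem cw_false_eq_last {i : Fin n} (hd : PrevGreater (word π) ((i : ℕ) + 1) 0)
    (ha : NextGreater (word π) ((i : ℕ) + 1) n) (hn : n - 1 < n) :
    (PhiMap π hπ).cw (i, false) = (⟨n - 1, hn⟩, false) := by
  have hv := (nextGreater_headOf π hπ i).unique ha
  refine cw_eq π hπ ⟨(originOf_false_eq_iff π hπ _ _).2 ?_, Or.inr ⟨?_, ?_⟩⟩
  · show NextGreater _ (n - 1 + 1) (headOf π hπ i).1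
    rw [hv, show n - 1 + 1 = n by omega]
    exact ⟨le_rfl, fun x _ _ => by omega, (isBordered_word π).lt_last n le_rfl⟩
  · rintro ⟨x, c⟩ ho
    cases c
    · obtain ⟨h1, h2, h3⟩ := (originOf_false_eq_iff π hπ _ _).1 ho
      simp only [originOf, Bool.false_eq_true, if_false, hv] at h1 h2 h3
      simp only [clockwiseRank, Bool.false_eq_true, if_false]
      by_contra hlt
      have := h2 (i + 1) (by omega) (by omega)
      have := hd.2.1 (x + 1) (by omega) (by omega)
      omega
    · simp only [clockwiseRank, Bool.false_eq_true, if_true, if_false]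
      omega
  · rintro ⟨x, c⟩ ho
    cases c
    · simp only [clockwiseRank, Bool.false_eq_true, if_false]
      omega
    · have h1 := ((originOf_true_eq_iff π hπ _ _).1 ho).1
      simp only [originOf, Bool.false_eq_true, if_false, hv] at h1
      omega

end Faces
-- Faces as orbits numbered by descents
section FaceStructure

variable {n : ℕ} {π : Equiv.Perm (Fin n)} (hπ : IsBaxter π)

/-- The next half-edge along the border of a face, on the half-edges of `Φ(π)`. -/
noncomputable def faceNext : Equiv.Perm (Fin n × Bool) := (PhiMap π hπ).faceStep

theorem faceNext_eq_of_cw {x y : Fin n × Bool} (h : (PhiMap π hπ).cw (x.1, !x.2) = y) :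
    faceNext hπ x = y := h

/-- A border edge of number `d ≠ 0` forces a descent at `d`, and then the previous greater letter of
`d + 1` is at `d`. The half-edge `(d, true)` serves as representative of the face. -/
theorem HasFace.self {d : Fin n} {x : Fin n × Bool} (h : HasFace π d x) :
    HasFace π d (d, true) := by
  obtain ⟨i, b⟩ := x
  refine ⟨Nat.lt_succ_self _, fun x h1 h2 => ?_, ?_⟩
  · simp only at h1 h2; omega
  simp only
  by_cases hd : (d : ℕ) = 0
  · exact Or.inl hd
  right
  cases b
  · simp only [HasFace, Bool.false_eq_true, if_false, if_neg hd] at h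
    obtain ⟨h1, h2, h3, h4⟩ := h
    have h5 := d.2
    rcases h1.eq_or_lt with h6 | h6
    · rw [h6] at h4; omega
    · have := h3 d h6 le_rfl; omega
  · simp only [HasFace, if_true] at h
    obtain ⟨h1, h2, h3⟩ := h
    rcases (show (d : ℕ) + 1 ≤ i + 1 by omega).eq_or_lt with h6 | h6
    · rw [h6]; omega
    · have := h2 _ (by omega) h6; omega

/-- The walk goes down the left border with decreasing positions, until it turns at the source to
the first edge of the right border. -/
theorem faceNext_false {d i : Fin n} (h : HasFace π d (i, false)) :
    faceNext hπ (i, false) = (d, true) ∨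
      ∃ k < i, HasFace π d (k, false) ∧ faceNext hπ (i, false) = (k, false) := by
  have ha := prevSmaller_tailOf π hπ i
  set a := (tailOf π hπ i).1
  clear_value a
  have hi := i.2
  have hd := d.2
  have hai := ha.1
  simp only [HasFace, Bool.false_eq_true, if_false] at h ⊢
  rcases h.prevSmaller_cases (isBordered_word π) ha with ⟨h1, h2⟩ | ⟨h1, h2⟩ | ⟨h1, h2⟩
  · have h3 : (d : ℕ) ≠ 0 := fun h0 => by simp [h0] at h1
    rw [if_neg h3] at h h2
    exact Or.inl (faceNext_eq_of_cw hπ (cw_true_eq_true hπ h ha hd h2))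
  · obtain ⟨k, rfl⟩ : ∃ k, a = k + 1 := ⟨a - 1, by omega⟩
    exact Or.inr ⟨⟨k, by omega⟩, Fin.lt_def.2 (by simp only; omega), h2,
      faceNext_eq_of_cw hπ (cw_true_eq_false hπ (k := ⟨k, by omega⟩) h ha h2)⟩
  · have h3 : (d : ℕ) = 0 := by
      by_contra h0
      rw [if_neg h0] at h1; omega
    rw [if_pos h3] at h
    left
    rw [show d = ⟨0, by omega⟩ from Fin.ext h3]
    exact faceNext_eq_of_cw hπ (cw_true_eq_first hπ h (h2 ▸ ha) (by omega))

/-- The walk goes up the right border with increasing positions, until it turns at the sink to the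
left border. -/
theorem faceNext_true {d i : Fin n} (h : HasFace π d (i, true)) :
    (∃ k, HasFace π d (k, false) ∧ faceNext hπ (i, true) = (k, false)) ∨
      ∃ k, i < k ∧ HasFace π d (k, true) ∧ faceNext hπ (i, true) = (k, true) := by
  have ha := nextGreater_headOf π hπ i
  have han := (headOf π hπ i).2.1
  set a := (headOf π hπ i).1
  clear_value a
  have hi := i.2
  have hd := d.2
  have hai := ha.1
  simp only [HasFace, Bool.false_eq_true, if_true, if_false] at h ⊢
  rcases h.nextGreater_cases (isBordered_word π) ha han with ⟨h1, h2⟩ | ⟨h1, h2⟩ | ⟨h1, h2⟩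
  · obtain ⟨d, hd⟩ := d
    obtain ⟨k, rfl⟩ : ∃ k, d = k + 1 := ⟨d - 1, by simp only at h1; omega⟩
    refine Or.inl ⟨⟨k, by omega⟩, ?_,
      faceNext_eq_of_cw hπ (cw_false_eq_false hπ (k := ⟨k, by omega⟩) h ha h2)⟩
    rw [if_neg (by simp)]
    have h3 : word π (k + 1 + 1) < word π (k + 1) := by
      obtain ⟨h4, h5, h6⟩ := h
      simp only at h4 h5 h6
      rcases (show k + 1 + 1 ≤ i + 1 by omega).eq_or_lt with h7 | h7
      · rw [h7]; omega
      · have := h5 _ (by omega) h7; omega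
    exact ⟨le_rfl, by simp only; omega, fun x _ _ => by simp only at *; omega, Or.inr h3⟩
  · exact Or.inr ⟨⟨a, h1⟩, Fin.lt_def.2 (by simp only; omega), h2,
      faceNext_eq_of_cw hπ (cw_false_eq_true hπ (k := ⟨a, h1⟩) h ha h2)⟩
  · refine Or.inl ⟨⟨n - 1, by omega⟩, ?_,
      faceNext_eq_of_cw hπ (cw_false_eq_last hπ (h1 ▸ h) (h2 ▸ ha) (by omega))⟩
    rw [if_pos h1]
    exact ⟨by simp only; omega, le_rfl, fun x _ _ => by simp only at *; omega, Or.inl rfl⟩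

theorem HasFace.next {d : Fin n} {x : Fin n × Bool} (h : HasFace π d x) :
    HasFace π d (faceNext hπ x) := by
  obtain ⟨i, b⟩ := x
  cases b
  · rcases faceNext_false hπ h with h' | ⟨k, -, hk, h'⟩ <;> rw [h']
    · exact h.self
    · exact hk
  · rcases faceNext_true hπ h with ⟨k, hk, h⟩ | ⟨k, -, hk, h⟩ <;> rw [h] <;> exact hk

theorem HasFace.sameCycle_false {d i : Fin n} (h : HasFace π d (i, false)) :
    (faceNext hπ).SameCycle (i, false) (d, true) := by
  induction i using WellFoundedLT.induction with
  | ind i ih =>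
    have h1 : (faceNext hπ).SameCycle (i, false) (faceNext hπ (i, false)) := ⟨1, by simp⟩
    rcases faceNext_false hπ h with h2 | ⟨k, hk, h3, h2⟩ <;> rw [h2] at h1
    · exact h1
    · exact h1.trans (ih k hk h3)

/-- Monotonicity of positions along each border makes the walk reach `(d, true)`, so the half-edges
of number `d` lie in a single orbit. `HasFace.of_sameCycle` gives the converse: an orbit keeps its
number. -/
theorem HasFace.sameCycle {d : Fin n} {x : Fin n × Bool} (h : HasFace π d x) :
    (faceNext hπ).SameCycle x (d, true) := by
  obtain ⟨i, b⟩ := x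
  cases b
  · exact h.sameCycle_false hπ
  · induction i using WellFoundedGT.induction with
    | ind i ih =>
      have h1 : (faceNext hπ).SameCycle (i, true) (faceNext hπ (i, true)) := ⟨1, by simp⟩
      rcases faceNext_true hπ h with ⟨k, h3, h2⟩ | ⟨k, hk, h3, h2⟩ <;> rw [h2] at h1
      · exact h1.trans (h3.sameCycle_false hπ)
      · exact h1.trans (ih k hk h3)

theorem HasFace.of_sameCycle {d : Fin n} {x y : Fin n × Bool} (h : HasFace π d x)
    (hxy : (faceNext hπ).SameCycle x y) : HasFace π d y := by
  obtain ⟨k, -, rfl⟩ := hxy.exists_pow_eq'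
  clear hxy
  induction k with
  | zero => exact h
  | succ k ih =>
    rw [pow_succ', Equiv.Perm.mul_apply]
    exact ih.next hπ

/-- The face number `d`, if there is one. -/
noncomputable def faceAt (d : Fin n) : (PhiMap π hπ).Face := (PhiMap π hπ).leftFace d

theorem mk_eq_faceAt_iff {d : Fin n} (hd : HasFace π d (d, true)) (x : Fin n × Bool) :
    (Quotient.mk _ x : (PhiMap π hπ).Face) = faceAt hπ d ↔ HasFace π d x := by
  refine Quotient.eq.trans ⟨fun h => ?_, fun h => h.sameCycle hπ⟩
  exact hd.of_sameCycle hπ (Equiv.Perm.SameCycle.symm h)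

theorem leftFace_eq_iff {d : Fin n} (hd : HasFace π d (d, true)) (e : Fin n) :
    (PhiMap π hπ).leftFace e = faceAt hπ d ↔ PrevGreater (word π) ((e : ℕ) + 1) d :=
  mk_eq_faceAt_iff hπ hd (e, true)

theorem rightFace_eq_iff {d : Fin n} (hd : HasFace π d (d, true)) (h0 : (d : ℕ) ≠ 0) (e : Fin n) :
    (PhiMap π hπ).rightFace e = faceAt hπ d ↔ NextSmaller n (word π) ((e : ℕ) + 1) d := by
  refine (mk_eq_faceAt_iff hπ hd (e, false)).trans ?_
  simp [HasFace, h0]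

theorem exists_eq_faceAt (f : (PhiMap π hπ).Face) :
    ∃ d : Fin n, HasFace π d (d, true) ∧ f = faceAt hπ d := by
  induction f using Quotient.inductionOn with
  | h x =>
    obtain ⟨d, hdn, hd⟩ := exists_hasFace π x
    have hd : HasFace π ((⟨d, hdn⟩ : Fin n) : ℕ) x := hd
    exact ⟨⟨d, hdn⟩, hd.self, (mk_eq_faceAt_iff hπ hd.self x).2 hd⟩

theorem isOuter_faceAt_iff {d : Fin n} (hd : HasFace π d (d, true)) :
    (Phi π hπ).IsOuter (faceAt hπ d) ↔ (d : ℕ) = 0 := by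
  have hn : 0 < n := d.pos
  have h0 : (tailOf π hπ ⟨0, hn⟩).1 = 0 := by
    have := (prevSmaller_tailOf π hπ ⟨0, hn⟩).1
    simp only at this
    omega
  have hle : ∀ e : Fin n, (tailOf π hπ e).1 = 0 →
      clockwiseKey π hπ (⟨0, hn⟩, true) ≤ clockwiseKey π hπ (e, true) := by
    intro e he
    rw [clockwiseKey_le_iff π hπ (d := (⟨0, hn⟩, true)) (d' := (e, true))
      (Subtype.ext (h0.trans he.symm))]
    -- The edge at position `1` has rank `0`, so it comes first around `w_0`.
    exact Nat.zero_le _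
  constructor
  · rintro ⟨e, h1, h2, h3⟩
    have h4 : e = ⟨0, hn⟩ := congrArg Prod.fst (clockwiseKey_injOn π hπ (e, true) (⟨0, hn⟩, true)
      (Subtype.ext (h1.trans h0.symm)) (le_antisymm (h2 _ h0) (hle e h1)))
    subst h4
    have := ((leftFace_eq_iff hπ hd _).1 h3.symm).1
    simp only at this
    omega
  · intro h
    exact ⟨⟨0, hn⟩, h0, hle, congrArg (PhiMap π hπ).leftFace (Fin.ext h)⟩

variable {hπ}

/-! ### Source, sink and side vertices of an inner face -/

theorem isBorderEdge_iff {d : Fin n} (hd : HasFace π d (d, true)) (h0 : (d : ℕ) ≠ 0) (e : Fin n) :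
    (PhiMap π hπ).IsBorderEdge e (faceAt hπ d) ↔
      PrevGreater (word π) ((e : ℕ) + 1) d ∨ NextSmaller n (word π) ((e : ℕ) + 1) d :=
  or_congr (leftFace_eq_iff hπ hd e) (rightFace_eq_iff hπ hd h0 e)

theorem HasFace.descent {d : Fin n} (hd : HasFace π d (d, true)) (h0 : (d : ℕ) ≠ 0) :
    word π ((d : ℕ) + 1) < word π d := by
  have := hd.2.2
  simp only at this
  omega

theorem nextSmaller_self {d : Fin n} (hd : HasFace π d (d, true)) (h0 : (d : ℕ) ≠ 0) :
    NextSmaller n (word π) d d :=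
  ⟨le_rfl, d.2.le, fun x _ _ => by omega, Or.inr (hd.descent h0)⟩

theorem isFaceSink_iff_border {d : Fin n} (hd : HasFace π d (d, true)) (h0 : (d : ℕ) ≠ 0)
    (v : Ascent π) : (PhiMap π hπ).IsFaceSink v (faceAt hπ d) ↔
      (∃ e : Fin n, (PrevGreater (word π) ((e : ℕ) + 1) d ∨
          NextSmaller n (word π) ((e : ℕ) + 1) d) ∧ headOf π hπ e = v) ∧
        ∀ e : Fin n, PrevGreater (word π) ((e : ℕ) + 1) d ∨
          NextSmaller n (word π) ((e : ℕ) + 1) d → tailOf π hπ e ≠ v :=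
  and_congr (exists_congr fun e => and_congr_left' (isBorderEdge_iff hd h0 e))
    (forall_congr' fun e => imp_congr_left (isBorderEdge_iff hd h0 e))

theorem isFaceSource_iff_border {d : Fin n} (hd : HasFace π d (d, true)) (h0 : (d : ℕ) ≠ 0)
    (v : Ascent π) : (PhiMap π hπ).IsFaceSource v (faceAt hπ d) ↔
      (∃ e : Fin n, (PrevGreater (word π) ((e : ℕ) + 1) d ∨
          NextSmaller n (word π) ((e : ℕ) + 1) d) ∧ tailOf π hπ e = v) ∧
        ∀ e : Fin n, PrevGreater (word π) ((e : ℕ) + 1) d ∨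
          NextSmaller n (word π) ((e : ℕ) + 1) d → headOf π hπ e ≠ v :=
  and_congr (exists_congr fun e => and_congr_left' (isBorderEdge_iff hd h0 e))
    (forall_congr' fun e => imp_congr_left (isBorderEdge_iff hd h0 e))

/-- Edge `d` is the last one of the left border, and its head is the sink. The end of any border
edge is either this vertex or the start of another border edge. -/
theorem isFaceSink_iff {d : Fin n} (hd : HasFace π d (d, true)) (h0 : (d : ℕ) ≠ 0)
    (v : Ascent π) :
    (PhiMap π hπ).IsFaceSink v (faceAt hπ d) ↔ NextGreater (word π) d v.1 := by
  rw [isFaceSink_iff_border hd h0]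
  constructor
  · rintro ⟨⟨e, he, hv⟩, hno⟩
    have hv := (headOf_eq_iff π hπ e v).1 hv
    by_contra hna
    rcases he with he | he
    · rcases he.nextGreater_cases (isBordered_word π) hv v.2.1 with h | ⟨h1, h2⟩ | h
      · exact hna h.2
      · exact hno ⟨v.1, h1⟩ (Or.inl h2) ((tailOf_eq_iff π hπ _ v).2 hv.prevSmaller_succ)
      · exact h0 h.1
    · obtain ⟨-, k, hk1, hk2, h1, h2⟩ := he.exists_next (isBordered_word π) d.2 hv hna
      obtain ⟨k, rfl⟩ : ∃ k', k = k' + 1 := ⟨k - 1, by omega⟩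
      exact hno ⟨k, hk2⟩ (Or.inr h2) ((tailOf_eq_iff π hπ _ v).2 h1)
  · intro hv
    have hd1 : (d : ℕ) - 1 + 1 = d := by omega
    refine ⟨⟨⟨(d : ℕ) - 1, by omega⟩, Or.inr ?_, (headOf_eq_iff π hπ _ v).2 ?_⟩, ?_⟩
    · simpa only [hd1] using nextSmaller_self hd h0
    · simpa only [hd1] using hv
    · rintro e (he | he) ht
      · exact he.not_prevSmaller_sink (by omega) hv ((tailOf_eq_iff π hπ e v).1 ht)
      · exact he.not_prevSmaller_sink hv ((tailOf_eq_iff π hπ e v).1 ht)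

/-- Dual to the sink: edge `d + 1` is the first one of the right border, and its tail is the source.
-/
theorem isFaceSource_iff {d : Fin n} (hd : HasFace π d (d, true)) (h0 : (d : ℕ) ≠ 0)
    (v : Ascent π) :
    (PhiMap π hπ).IsFaceSource v (faceAt hπ d) ↔ PrevSmaller (word π) ((d : ℕ) + 1) v.1 := by
  rw [isFaceSource_iff_border hd h0]
  constructor
  · rintro ⟨⟨e, he, hv⟩, hno⟩
    have hv := (tailOf_eq_iff π hπ e v).1 hv
    by_contra hna
    rcases he with he | he
    · obtain ⟨-, k, hk1, hk2, h1, h2⟩ :=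
        he.exists_prev (isBordered_word π) (by omega) (by omega) hv hna
      obtain ⟨k, rfl⟩ : ∃ k', k = k' + 1 := ⟨k - 1, by omega⟩
      exact hno ⟨k, hk2⟩ (Or.inl h2) ((headOf_eq_iff π hπ _ v).2 h1)
    · rcases he.prevSmaller_cases (isBordered_word π) hv with h | ⟨h1, h2⟩ | h
      · exact hna h.2
      · have hv1 : v.1 - 1 + 1 = v.1 := by omega
        have := v.2.1
        refine hno ⟨v.1 - 1, by omega⟩ (Or.inr ?_) ((headOf_eq_iff π hπ _ v).2 ?_)
        · simpa only [hv1] using h2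
        · simpa only [hv1] using hv.nextGreater_self
      · have := d.2; omega
  · intro hv
    refine ⟨⟨d, Or.inl hd, (tailOf_eq_iff π hπ _ v).2 hv⟩, ?_⟩
    rintro e (he | he) ht
    · exact he.not_nextGreater_source hv ((headOf_eq_iff π hπ e v).1 ht)
    · exact he.not_nextGreater_source d.2 hv ((headOf_eq_iff π hπ e v).1 ht)

theorem isLeftVertex_iff_border {d : Fin n} (hd : HasFace π d (d, true)) (h0 : (d : ℕ) ≠ 0)
    (v : Ascent π) : (PhiMap π hπ).IsLeftVertex v (faceAt hπ d) ↔
      (∃ e : Fin n, NextSmaller n (word π) ((e : ℕ) + 1) d ∧ (tailOf π hπ e = v ∨ headOf π hπ e = v)) ∧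
        ¬ PrevSmaller (word π) ((d : ℕ) + 1) v.1 ∧ ¬ NextGreater (word π) d v.1 :=
  and_congr (exists_congr fun e => and_congr_left' (rightFace_eq_iff hπ hd h0 e))
    (and_congr (not_congr (isFaceSource_iff hd h0 v)) (not_congr (isFaceSink_iff hd h0 v)))

/-- The left border edge that enters an intermediate vertex `v` is at position `v`, the rightmost of
the edges entering `v`. -/
theorem isLeftVertex_iff {d : Fin n} (hd : HasFace π d (d, true)) (h0 : (d : ℕ) ≠ 0)
    (v : Ascent π) :
    (PhiMap π hπ).IsLeftVertex v (faceAt hπ d) ↔ 1 ≤ v.1 ∧ NextSmaller n (word π) v.1 d := by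
  rw [isLeftVertex_iff_border hd h0]
  constructor
  · rintro ⟨⟨e, he, hv | hv⟩, h1, h2⟩
    · rcases he.prevSmaller_cases (isBordered_word π) ((tailOf_eq_iff π hπ e v).1 hv) with
        h | h | h
      · exact absurd h.2 h1
      · exact h
      · have := d.2; omega
    · have := (he.exists_next (isBordered_word π) d.2 ((headOf_eq_iff π hπ e v).1 hv) h2).1
      exact ⟨by omega, this ▸ he⟩
  · rintro ⟨h1, h2⟩
    have hv1 : v.1 - 1 + 1 = v.1 := by omega
    have hvn := v.2.1
    have hvv : NextGreater (word π) v.1 v.1 := ⟨le_rfl, fun x _ _ => by omega, v.2.2⟩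
    refine ⟨⟨⟨v.1 - 1, by omega⟩, by simpa only [hv1] using h2,
      Or.inr ((headOf_eq_iff π hπ _ v).2 (by simpa only [hv1] using hvv))⟩, fun h => ?_, fun h => ?_⟩
    · exact h2.not_nextGreater_source d.2 h hvv
    · have h3 : v.1 = d := le_antisymm h2.1 h.1
      have h4 := hd.descent h0
      have h5 := v.2.2
      rw [h3] at h5
      omega

theorem isRightVertex_iff_border {d : Fin n} (hd : HasFace π d (d, true)) (h0 : (d : ℕ) ≠ 0)
    (v : Ascent π) : (PhiMap π hπ).IsRightVertex v (faceAt hπ d) ↔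
      (∃ e : Fin n, PrevGreater (word π) ((e : ℕ) + 1) d ∧ (tailOf π hπ e = v ∨ headOf π hπ e = v)) ∧
        ¬ PrevSmaller (word π) ((d : ℕ) + 1) v.1 ∧ ¬ NextGreater (word π) d v.1 :=
  and_congr (exists_congr fun e => and_congr_left' (leftFace_eq_iff hπ hd e))
    (and_congr (not_congr (isFaceSource_iff hd h0 v)) (not_congr (isFaceSink_iff hd h0 v)))

/-- The right border edge that leaves an intermediate vertex `v` is at position `v + 1`, the
leftmost of the edges leaving `v`. -/
theorem isRightVertex_iff {d : Fin n} (hd : HasFace π d (d, true)) (h0 : (d : ℕ) ≠ 0)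
    (v : Ascent π) :
    (PhiMap π hπ).IsRightVertex v (faceAt hπ d) ↔
      v.1 < n ∧ PrevGreater (word π) (v.1 + 1) d := by
  rw [isRightVertex_iff_border hd h0]
  constructor
  · rintro ⟨⟨e, he, hv | hv⟩, h1, h2⟩
    · have := (he.exists_prev (isBordered_word π) (by omega) (by omega)
        ((tailOf_eq_iff π hπ e v).1 hv) h1).1
      exact ⟨by have := e.2; omega, this ▸ he⟩
    · rcases he.nextGreater_cases (isBordered_word π) ((headOf_eq_iff π hπ e v).1 hv) v.2.1 with
        h | h | h
      · exact absurd h.2 h2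
      · exact h
      · exact absurd h.1 h0
  · rintro ⟨h1, h2⟩
    have hvv : PrevSmaller (word π) (v.1 + 1) v.1 :=
      ⟨Nat.lt_succ_self _, fun x _ _ => by omega, v.2.2⟩
    refine ⟨⟨⟨v.1, h1⟩, h2, Or.inl ((tailOf_eq_iff π hπ _ v).2 hvv)⟩, fun h => ?_, fun h => ?_⟩
    · have h3 : v.1 = d := by have := h2.1; have := h.1; omega
      have h4 := hd.descent h0
      have h5 := v.2.2
      rw [h3] at h5
      omega
    · exact h2.not_prevSmaller_sink (by omega) h hvv

/-! ## Pieces and patterns -/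

theorem exists_isROP_iff : (∃ v₁ v₂ f₁ f₂, (Phi π hπ).IsROP v₁ v₂ f₁ f₂) ↔
    ∃ v₁ v₂ d₁ d₂, IsRightPiece n (word π) v₁ v₂ d₁ d₂ := by
  constructor
  · rintro ⟨v₁, v₂, f₁, f₂, o₁, o₂, h₁, h₂, h₃, h₄⟩
    obtain ⟨d₁, hd₁, rfl⟩ := exists_eq_faceAt hπ f₁
    obtain ⟨d₂, hd₂, rfl⟩ := exists_eq_faceAt hπ f₂
    rw [isOuter_faceAt_iff hπ hd₁] at o₁
    rw [isOuter_faceAt_iff hπ hd₂] at o₂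
    have h₁ := (isFaceSource_iff hd₁ o₁ v₁).1 h₁
    have h₂ := (isLeftVertex_iff hd₂ o₂ v₁).1 h₂
    have h₃ := (isFaceSink_iff hd₂ o₂ v₂).1 h₃
    have h₄ := (isRightVertex_iff hd₁ o₁ v₂).1 h₄
    exact ⟨v₁.1, v₂.1, d₁, d₂, h₂.1, h₄.1, by omega, d₂.2, h₁, h₂.2, h₃, h₄.2⟩
  · rintro ⟨v₁, v₂, d₁, d₂, hv₁, hv₂, hd₁, hd₂, h₁, h₂, h₃, h₄⟩
    have a₁ := h₁.nextGreater_self.2.2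
    have a₂ := h₃.prevSmaller_succ.2.2
    have l₁ := h₁.1
    have l₂ := h₂.1
    have l₃ := h₄.1
    -- The numbers `d₁` and `d₂` belong to actual faces because each has a border edge, at position
    -- `v₂ + 1` and `v₁` respectively.
    have b₁ : HasFace π d₁ ((⟨v₂, hv₂⟩ : Fin n), true) := h₄
    have b₂ : HasFace π d₂ ((⟨v₁ - 1, by omega⟩ : Fin n), false) := by
      simpa [HasFace, show v₁ - 1 + 1 = v₁ by omega, show d₂ ≠ 0 by omega] using h₂
    have c₁ := HasFace.self (d := ⟨d₁, by omega⟩) b₁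
    have c₂ := HasFace.self (d := ⟨d₂, by omega⟩) b₂
    have o₁ : d₁ ≠ 0 := by omega
    have o₂ : d₂ ≠ 0 := by omega
    refine ⟨(⟨v₁, by omega, a₁⟩ : Ascent π), (⟨v₂, by omega, a₂⟩ : Ascent π),
      faceAt hπ ⟨d₁, by omega⟩, faceAt hπ ⟨d₂, by omega⟩, ?_, ?_, ?_, ?_, ?_, ?_⟩
    · rwa [isOuter_faceAt_iff hπ c₁]
    · rwa [isOuter_faceAt_iff hπ c₂]
    · exact (isFaceSource_iff c₁ o₁ _).2 h₁
    · exact (isLeftVertex_iff c₂ o₂ _).2 ⟨hv₁, h₂⟩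
    · exact (isFaceSink_iff c₂ o₂ _).2 h₃
    · exact (isRightVertex_iff c₁ o₁ _).2 ⟨hv₂, h₄⟩

theorem exists_isLOP_iff : (∃ v₁ v₂ f₁ f₂, (Phi π hπ).IsLOP v₁ v₂ f₁ f₂) ↔
    ∃ v₁ v₂ d₁ d₂, IsLeftPiece n (word π) v₁ v₂ d₁ d₂ := by
  constructor
  · rintro ⟨v₁, v₂, f₁, f₂, o₁, o₂, h₁, h₂, h₃, h₄⟩
    obtain ⟨d₁, hd₁, rfl⟩ := exists_eq_faceAt hπ f₁
    obtain ⟨d₂, hd₂, rfl⟩ := exists_eq_faceAt hπ f₂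
    rw [isOuter_faceAt_iff hπ hd₁] at o₁
    rw [isOuter_faceAt_iff hπ hd₂] at o₂
    have h₁ := (isFaceSource_iff hd₁ o₁ v₁).1 h₁
    have h₂ := (isRightVertex_iff hd₂ o₂ v₁).1 h₂
    have h₃ := (isFaceSink_iff hd₂ o₂ v₂).1 h₃
    have h₄ := (isLeftVertex_iff hd₁ o₁ v₂).1 h₄
    exact ⟨v₁.1, v₂.1, d₁, d₂, by omega, d₁.2, h₁, h₂.2, h₃, h₄.2⟩
  · rintro ⟨v₁, v₂, d₁, d₂, hd₂, hd₁, h₁, h₂, h₃, h₄⟩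
    have a₁ := h₁.nextGreater_self.2.2
    have a₂ := h₃.prevSmaller_succ.2.2
    have l₁ := h₁.1
    have l₂ := h₂.1
    have l₃ := h₃.1
    have l₄ := h₄.1
    have hv₁ : v₁ < n := by omega
    have b₁ : HasFace π d₂ ((⟨v₁, hv₁⟩ : Fin n), true) := h₂
    have b₂ : HasFace π d₁ ((⟨v₂ - 1, by omega⟩ : Fin n), false) := by
      simpa [HasFace, show v₂ - 1 + 1 = v₂ by omega, show d₁ ≠ 0 by omega] using h₄
    have c₁ := HasFace.self (d := ⟨d₁, by omega⟩) b₂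
    have c₂ := HasFace.self (d := ⟨d₂, by omega⟩) b₁
    have o₁ : d₁ ≠ 0 := by omega
    have o₂ : d₂ ≠ 0 := by omega
    refine ⟨(⟨v₁, by omega, a₁⟩ : Ascent π), (⟨v₂, by omega, a₂⟩ : Ascent π),
      faceAt hπ ⟨d₁, by omega⟩, faceAt hπ ⟨d₂, by omega⟩, ?_, ?_, ?_, ?_, ?_, ?_⟩
    · rwa [isOuter_faceAt_iff hπ c₁]
    · rwa [isOuter_faceAt_iff hπ c₂]
    · exact (isFaceSource_iff c₁ o₁ _).2 h₁
    · exact (isRightVertex_iff c₂ o₂ _).2 ⟨hv₁, h₂⟩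
    · exact (isFaceSink_iff c₂ o₂ _).2 h₃
    · exact (isLeftVertex_iff c₁ o₁ _).2 ⟨hd₂.trans l₃, h₄⟩

theorem containsPattern_iff {k : ℕ} (τ : Fin k → ℕ) :
    ContainsPattern π τ ↔ ∃ f : Fin k → ℕ, StrictMono f ∧ (∀ a, 1 ≤ f a ∧ f a ≤ n) ∧
      ∀ a b, word π (f a) < word π (f b) ↔ τ a < τ b := by
  constructor
  · rintro ⟨f, hf, h⟩
    refine ⟨fun a => (f a : ℕ) + 1, fun a b hab => ?_, fun a => ⟨Nat.succ_pos _, (f a).2⟩,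
      fun a b => ?_⟩
    · have := hf hab
      simp only
      omega
    · rw [← h, word_succ, word_succ, Fin.lt_def]
      omega
  · rintro ⟨f, hf, hn, h⟩
    have hf1 : ∀ a, f a - 1 + 1 = f a := fun a => by have := hn a; omega
    refine ⟨fun a => ⟨f a - 1, by have := hn a; omega⟩, fun a b hab => ?_, fun a b => ?_⟩
    · have := hf hab
      have := hn a
      simp only [Fin.lt_def]
      omega
    · have h1 := word_succ π ⟨f a - 1, by have := hn a; omega⟩
      have h2 := word_succ π ⟨f b - 1, by have := hn b; omega⟩
      simp only [hf1] at h1 h2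
      rw [← h, h1, h2, Fin.lt_def]
      exact (Nat.add_lt_add_iff_right).symm

theorem containsPattern_2413_iff :
    ContainsPattern π ![2, 4, 1, 3] ↔ ∃ p q r s, Is2413 n (word π) p q r s := by
  rw [containsPattern_iff]
  constructor
  · rintro ⟨f, hf, hn, h⟩
    exact ⟨f 0, f 1, f 2, f 3, (hn 0).1, hf (by decide), hf (by decide), hf (by decide), (hn 3).2,
      (h 2 0).2 (by decide), (h 0 3).2 (by decide), (h 3 1).2 (by decide)⟩
  · rintro ⟨p, q, r, s, h1, h2, h3, h4, h5, h6, h7, h8⟩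
    refine ⟨![p, q, r, s], ?_, ?_, ?_⟩
    · rw [Fin.strictMono_iff_lt_succ]
      intro i
      fin_cases i <;> assumption
    · intro a
      fin_cases a <;> simp <;> omega
    · intro a b
      fin_cases a <;> fin_cases b <;> simp <;> omega

theorem containsPattern_3142_iff :
    ContainsPattern π ![3, 1, 4, 2] ↔ ∃ p q r s, Is3142 n (word π) p q r s := by
  rw [containsPattern_iff]
  constructor
  · rintro ⟨f, hf, hn, h⟩
    exact ⟨f 0, f 1, f 2, f 3, (hn 0).1, hf (by decide), hf (by decide), hf (by decide), (hn 3).2,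
      (h 1 3).2 (by decide), (h 3 0).2 (by decide), (h 0 2).2 (by decide)⟩
  · rintro ⟨p, q, r, s, h1, h2, h3, h4, h5, h6, h7, h8⟩
    refine ⟨![p, q, r, s], ?_, ?_, ?_⟩
    · rw [Fin.strictMono_iff_lt_succ]
      intro i
      fin_cases i <;> assumption
    · intro a
      fin_cases a <;> simp <;> omega
    · intro a b
      fin_cases a <;> fin_cases b <;> simp <;> omega

end FaceStructure
end BaxterBipolar

theorem mainTheorem6 {n : ℕ} (π : Equiv.Perm (Fin n)) (hπ : BaxterBipolar.IsBaxter π) :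
    (BaxterBipolar.ContainsPattern π ![2, 4, 1, 3] ↔
      ∃ v₁ v₂ f₁ f₂, (BaxterBipolar.Phi π hπ).IsROP v₁ v₂ f₁ f₂) ∧
    (BaxterBipolar.ContainsPattern π ![3, 1, 4, 2] ↔
      ∃ v₁ v₂ f₁ f₂, (BaxterBipolar.Phi π hπ).IsLOP v₁ v₂ f₁ f₂) := by
  have hw := BaxterBipolar.isBordered_word π
  have hb : BaxterBipolar.IsBaxterWord n (BaxterBipolar.word π) := fun _ _ _ hij hjk hk =>
    BaxterBipolar.word_baxter π hπ hij hjk hk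
  rw [BaxterBipolar.containsPattern_2413_iff, BaxterBipolar.containsPattern_3142_iff,
    BaxterBipolar.exists_isROP_iff, BaxterBipolar.exists_isLOP_iff]
  exact ⟨⟨BaxterBipolar.exists_isRightPiece hw hb,
      fun ⟨_, _, _, _, h⟩ => ⟨_, _, _, _, h.is2413⟩⟩,
    ⟨BaxterBipolar.exists_isLeftPiece hw hb, fun ⟨_, _, _, _, h⟩ => ⟨_, _, _, _, h.is3142⟩⟩⟩
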